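/- **Setting.** Let $\mathbb T=\mathbb R/\mathbb Z$, $L^2=L^2(\mathbb T;\mathbb C)$ with $\langle f,g\rangle=\int f\bar g$, $e_k(x)=e^{2i\pi kx}$, and $H^s=\{u\in L^2:(1-\partial_x^2)^{s/2}u\in L^2\}$ for $s\ge 0$. Let $\chi,\rho\in C^\infty(\mathbb R;\mathbb R)$ be a dyadic partition of unity: $\chi$ is supported in a ball, $\rho$ in an annulus $\{r\le|z|\le R\}$ with $r>0$, $\chi(z)+\sum_{j\ge0}\rho(2^{-j}z)=1$ for all $z$, $\operatorname{supp}\chi\cap\operatorname{supp}\rho(2^{-j}\cdot)=\emptyset$ for $j\ge1$, and $\operatorname{supp}\rho(2^{-i}\cdot)\cap\operatorname{supp}\rho(2^{-j}\cdot)=\emptyset$ for $|i-j|>1$. For a distribution $u$ on $\mathbb T$ with Fourier coefficients $\hat u(k)$ set $\Delta_{-1}u=\sum_k\chi(k)\hat u(k)e_k$ and $\Delta_ju=\sum_k\rho(2^{-j}k)\hat u(k)e_k$ for $j\ge0$; let $\mathcal C^\alpha$ be the space of distributions with $\sup_{j\ge-1}2^{\alpha j}\|\Delta_ju\|_{L^\infty}<\infty$,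 and let $\mathsf P_uv=\sum_{n<m-1}\Delta_nu\,\Delta_mv$ be Bony's paraproduct. Let $\kappa\in(0,1)$ and let $V\in\mathcal C^{-1+\kappa}$ be a real distribution on $\mathbb T$. Let $X=\Delta^{-1}(V-\langle V,1\rangle)$, where $\Delta=\partial_x^2$ and $\Delta^{-1}$ is its inverse on mean-zero distributions, i.e. $\hat X(0)=0$ and $\hat X(k)=-\hat V(k)/(2\pi k)^2$ for $k\ne0$. Consider on $H^1$ the form $$\mathbf a(u,\varphi)=\langle\partial_xu,\partial_x\varphi\rangle+\langle Vu,\varphi\rangle,\qquad \langle Vu,\varphi\rangle=\sum_{k\in\mathbb Z}\hat V(k)\,\widehat{u\bar\varphi}(-k),$$ and let $$\mathcal D(\mathcal H)=\{u\in H^1:\ \exists v\in L^2,\ \forall\varphi\in H^1,\ \mathbf a(u,\varphi)=\langle v,\varphi\rangle\},\qquad \mathcal Hu=v,$$ $$\mathcal D_V=\{u\in L^2:\ u-\mathsf P_uX\in H^2\}.$$ **Proposition.** The series defining $\langle Vu,\varphi\rangle$ converges absolutely for all $u,\varphi\in H^1$, and the series defining $\mathsf P_uX$ converges unconditionally in $L^2$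 for every $u\in L^2$. Moreover $\mathcal D(\mathcal H)=\mathcal D_V$, and $\mathcal H=-\partial_x^2+V$ with domain $\mathcal D_V$ is a well-defined, densely defined, self-adjoint, closed linear operator in $L^2$. -/

import Mathlib

open MeasureTheory
open scoped ContDiff ComplexConjugate

noncomputable section

namespace PeriodicSchrodinger

/-! ### Smooth functions and distributions on the circle `𝕋 = ℝ / ℤ` -/

/-- The space `C^∞(𝕋)` of smooth complex-valued functions on `𝕋 = ℝ / ℤ`. -/
def SmoothFun : Submodule ℂ (UnitAddCircle → ℂ) where
  carrier := {f | ContDiff ℝ ∞ (fun x : ℝ => f (x : UnitAddCircle))}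
  add_mem' {f g} hf hg := by
    have hf' : ContDiff ℝ ∞ (fun x : ℝ => f (x : UnitAddCircle)) := hf
    have hg' : ContDiff ℝ ∞ (fun x : ℝ => g (x : UnitAddCircle)) := hg
    exact hf'.add hg'
  zero_mem' := (contDiff_const : ContDiff ℝ ∞ (fun _ : ℝ => (0 : ℂ)))
  smul_mem' c f hf := by
    have hf' : ContDiff ℝ ∞ (fun x : ℝ => f (x : UnitAddCircle)) := hf
    exact hf'.const_smul c

/-- A distribution on `𝕋`: a linear functional on `C^∞(𝕋)` which is continuous for the seminorms
`f ↦ sup_{k ≤ N} sup_x |f^{(k)}(x)|`. The pairing with test functions is bilinear. -/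
structure CircleDistribution where
  /-- The functional itself. -/
  toLinearMap : SmoothFun →ₗ[ℂ] ℂ
  continuous' : ∃ (C : ℝ) (N : ℕ), ∀ (f : SmoothFun) (M : ℝ),
    (∀ k ≤ N, ∀ x : ℝ, ‖iteratedDeriv k (fun y : ℝ => f.1 (y : UnitAddCircle)) x‖ ≤ M) →
      ‖toLinearMap f‖ ≤ C * M

/-- The exponential `e_k(x) = e^{2 i π k x}` as a smooth function on `𝕋`. -/
def expFun (k : ℤ) : SmoothFun :=
  ⟨fun x => fourier k x, by
    change ContDiff ℝ ∞ (fun x : ℝ => (fourier k (x : UnitAddCircle) : ℂ))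
    simp only [fourier_coe_apply]
    have h : ContDiff ℝ ∞ (fun x : ℝ => (x : ℂ)) := Complex.ofRealCLM.contDiff
    fun_prop⟩

/-- The `k`-th Fourier coefficient `⟨V, e_{-k}⟩` of a distribution. -/
def CircleDistribution.coeff (V : CircleDistribution) (k : ℤ) : ℂ := V.toLinearMap (expFun (-k))

/-- `V` is real: it takes real values on real-valued test functions. -/
def CircleDistribution.IsReal (V : CircleDistribution) : Prop :=
  ∀ f : SmoothFun, (∀ x, (f.1 x).im = 0) → (V.toLinearMap f).im = 0

/-! ### The spaces `L²(𝕋)` and `H^s(𝕋)` -/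

/-- `L²(𝕋; ℂ)`. -/
abbrev L2 : Type := Lp ℂ 2 (AddCircle.haarAddCircle : Measure UnitAddCircle)

/-- The Sobolev space `H^s(𝕋)`, `s ≥ 0`, of those `u ∈ L²` with `(1 - ∂_x²)^{s/2} u ∈ L²`. -/
def sobolev (s : ℝ) : Set L2 :=
  {u | Summable fun k : ℤ => (1 + (2 * Real.pi * (k : ℝ)) ^ 2) ^ s * ‖fourierCoeff u k‖ ^ 2}

/-- The derivative `∂_x u = ∑ 2 i π k û(k) e_k` (the series converges in `L²` for `u ∈ H^1`). -/
def dx (u : L2) : L2 :=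
  ∑' k : ℤ, (2 * Real.pi * Complex.I * (k : ℂ) * fourierCoeff u k) • fourierLp 2 k

/-! ### Littlewood-Paley blocks, Hölder-Besov spaces, paraproduct -/

/-- A (smooth) dyadic partition of unity on `ℝ`. -/
structure DyadicPartition where
  /-- The low-frequency cut-off. -/
  χ : ℝ → ℝ
  /-- The annular cut-off. -/
  ρ : ℝ → ℝ
  smooth_χ : ContDiff ℝ ∞ χ
  smooth_ρ : ContDiff ℝ ∞ ρ
  support_χ : ∃ R : ℝ, tsupport χ ⊆ {z | |z| ≤ R}
  support_ρ : ∃ r R : ℝ, 0 < r ∧ tsupport ρ ⊆ {z | r ≤ |z| ∧ |z| ≤ R}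
  sum_eq_one : ∀ z : ℝ, HasSum (fun j : ℕ => ρ (z / 2 ^ j)) (1 - χ z)
  disjoint_χ_ρ : ∀ j : ℕ, 1 ≤ j → Disjoint (tsupport χ) (tsupport fun z => ρ (z / 2 ^ j))
  disjoint_ρ_ρ : ∀ i j : ℕ, i + 1 < j →
    Disjoint (tsupport fun z => ρ (z / 2 ^ i)) (tsupport fun z => ρ (z / 2 ^ j))

/-- The Fourier multipliers of the blocks, indexed by `ℕ` instead of `{-1, 0, 1, …}`:
index `0` is the block `Δ_{-1}` and index `j + 1` is the block `Δ_j`. -/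
def DyadicPartition.cutoff (D : DyadicPartition) : ℕ → ℝ → ℝ
  | 0 => D.χ
  | j + 1 => fun z => D.ρ (z / 2 ^ j)

/-- The Littlewood-Paley block `Δ_{j-1}` of the distribution with Fourier coefficients `c`; it is
a trigonometric polynomial (all but finitely many terms of the sum vanish). -/
def block (D : DyadicPartition) (j : ℕ) (c : ℤ → ℂ) : C(UnitAddCircle, ℂ) :=
  ∑' k : ℤ, ((D.cutoff j (k : ℝ) : ℂ) * c k) • fourier k

/-- The distribution with Fourier coefficients `c` belongs to the Hölder-Besov space
`C^α = B^α_{∞,∞}`, i.e. `sup_{j ≥ -1} 2^{α j} ‖Δ_j‖_{L^∞} < ∞`. -/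
def MemHolderBesov (D : DyadicPartition) (α : ℝ) (c : ℤ → ℂ) : Prop :=
  ∃ C : ℝ, ∀ j : ℕ, (2 : ℝ) ^ (α * ((j : ℝ) - 1)) * ‖block D j c‖ ≤ C

/-- The term `Δ_n u Δ_m X` (for `n < m - 1`, and zero for the other pairs) of the paraproduct,
where `X` has Fourier coefficients `c`; the shift of both indices by one does not change the
condition `n < m - 1`. -/
def paraTerm (D : DyadicPartition) (u : L2) (c : ℤ → ℂ) (p : ℕ × ℕ) : L2 :=
  if p.1 + 1 < p.2 then
    ContinuousMap.toLp 2 AddCircle.haarAddCircle ℂ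
      (block D p.1 (fourierCoeff u) * block D p.2 c)
  else 0

/-- Bony's paraproduct `P_u X = ∑_{n < m - 1} Δ_n u Δ_m X`, as a series in `L²`, where `X` has
Fourier coefficients `c`. -/
def paraproduct (D : DyadicPartition) (u : L2) (c : ℤ → ℂ) : L2 := ∑' p : ℕ × ℕ, paraTerm D u c p

/-! ### The operator `H = -∂_x² + V` -/

/-- The Fourier coefficients of `X = Δ^{-1} (V - ⟨V, 1⟩)`, where `Δ = ∂_x²` and `Δ^{-1}` is its
inverse on mean-zero distributions: `X̂(k) = - V̂(k) / (2πk)²` for `k ≠ 0` and `X̂(0) = 0`. -/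
def invLaplaceCoeff (V : CircleDistribution) (k : ℤ) : ℂ :=
  if k = 0 then 0 else -(V.coeff k) / (2 * Real.pi * (k : ℂ)) ^ 2

/-- The terms of the duality pairing
`⟨V u, φ⟩ = ⟨V, u φ̄⟩ = ∑ V̂(k) (u φ̄)^(-k)` for `u, φ ∈ H^1`. -/
def potentialTerm (V : CircleDistribution) (u φ : L2) (k : ℤ) : ℂ :=
  V.coeff k * fourierCoeff (fun x : UnitAddCircle => u x * conj (φ x)) (-k)

/-- The form `a(u, φ) = ⟨∂_x u, ∂_x φ⟩ + ⟨V u, φ⟩` on `H^1`, where `⟨f, g⟩ = ∫ f ḡ`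
(Mathlib's `inner` is conjugate-linear in its first argument). -/
def form (V : CircleDistribution) (u φ : L2) : ℂ :=
  inner ℂ (dx φ) (dx u) + ∑' k : ℤ, potentialTerm V u φ k

/-- `u ∈ H^1` and `v ∈ L²` satisfy `a(u, φ) = ⟨v, φ⟩` for all `φ ∈ H^1`, that is `H u = v`. -/
def IsImage (V : CircleDistribution) (u v : L2) : Prop :=
  u ∈ sobolev 1 ∧ ∀ φ ∈ sobolev 1, form V u φ = inner ℂ φ v

/-- The domain of `H` defined through its form:
`D(H) = {u ∈ H^1 ; ∃ v ∈ L², ∀ φ ∈ H^1, a(u, φ) = ⟨v, φ⟩}`. -/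
def formOperatorDomain (V : CircleDistribution) : Set L2 := {u | ∃ v : L2, IsImage V u v}

/-- The paracontrolled domain `D_V = {u ∈ L² ; u - P_u X ∈ H²}`. -/
def paracontrolledDomain (D : DyadicPartition) (V : CircleDistribution) : Set L2 :=
  {u | u - paraproduct D u (invLaplaceCoeff V) ∈ sobolev 2}

end PeriodicSchrodinger

end

noncomputable section

namespace PeriodicSchrodinger

/-! ### Fourier series in `L²` -/

/-! Everything is done on Fourier coefficients. The Hölder-Besov hypothesis enters only as a
geometric bound `‖Δ_m V‖_∞ ≤ C 2^m q^m` with `q = 2^(-κ) < 1`, recorded with `q = s ^ 2` in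
`BlockBound`.

Since `L^∞` embeds in `L²`, this bound puts `V` in `H^{-1}` (`summable_div_one_add_abs`). The
pairing `⟨V u, φ⟩` is then an absolutely convergent double series on `H^1`
(`summable_potential_form`), and `H u = v` means that `(2πj)² û(j) + (V u)^(j) = v̂(j)` for every
`j` (`isImage_iff`).

For the domain, the key fact is that `V u - ∂_x² P_u X` lies in `L²` when `u ∈ H^1`
(`BlockBound.summable_potential_add`). In the terms with `n < m - 1`, Leibniz' rule for `∂_x²(Δ_n u
Δ_m X)` leaves derivatives on the low-frequency factor `Δ_n u`. In the other terms `Δ_n u` has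
essentially the higher frequency, and its `H^1` decay pays for the growth of `Δ_m V`. Writing `-∂_x²
u + V u = -∂_x²(u - P_u X) + (V u - ∂_x² P_u X)` shows that `H u ∈ L²` exactly when `u - P_u X ∈
H²`. Conversely `u ∈ D_V` is in `H^1`, because `P_u X ∈ H^1` already for `u ∈ L²`.

For self-adjointness, the form is symmetric because `V` is real. Substituting `u = (μ - ∂_x²)^{-1/2}
f` turns the shifted form into the inner product plus a bounded form whose norm tends to zero as `μ
→ ∞`. A Neumann series then makes `H + μ` onto (`exists_shift_surjective`), and a symmetric operator
with a surjective real shift is densely defined and self-adjoint (`isSelfAdjoint_of_surjective`),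
hence closed. -/

theorem inner_fourierLp (u : L2) (k : ℤ) : inner ℂ (fourierLp 2 k) u = fourierCoeff u k := by
  rw [← fourierBasis_repr, HilbertBasis.repr_apply_apply, coe_fourierBasis]

theorem fourierCoeff_add (u v : L2) (k : ℤ) :
    fourierCoeff (u + v : L2) k = fourierCoeff u k + fourierCoeff v k := by
  simp only [← inner_fourierLp, inner_add_right]

theorem fourierCoeff_sub (u v : L2) (k : ℤ) :
    fourierCoeff (u - v : L2) k = fourierCoeff u k - fourierCoeff v k := by
  simp only [← inner_fourierLp, inner_sub_right]

theorem fourierCoeff_smul (c : ℂ) (u : L2) (k : ℤ) :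
    fourierCoeff (c • u : L2) k = c * fourierCoeff u k := by
  simp only [← inner_fourierLp, inner_smul_right]

theorem fourierCoeff_zero (k : ℤ) : fourierCoeff (0 : L2) k = 0 := by
  simp only [← inner_fourierLp, inner_zero_right]

theorem hasSum_fourierCoeff {ι : Type*} {f : ι → L2} {u : L2} (h : HasSum f u) (k : ℤ) :
    HasSum (fun i => fourierCoeff (f i) k) (fourierCoeff u k) := by
  simp only [← inner_fourierLp]
  exact h.mapL (innerSL ℂ (fourierLp 2 k : L2))

theorem ext_fourierCoeff {u v : L2} (h : ∀ k, fourierCoeff u k = fourierCoeff v k) : u = v := by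
  apply fourierBasis.repr.injective
  ext k
  rw [fourierBasis_repr, fourierBasis_repr, h]

theorem hasSum_inner (u v : L2) :
    HasSum (fun k => conj (fourierCoeff u k) * fourierCoeff v k) (inner ℂ u v) := by
  have h := fourierBasis.hasSum_inner_mul_inner u v
  simp only [coe_fourierBasis, inner_fourierLp] at h
  simpa only [← inner_conj_symm u, inner_fourierLp] using h

theorem hasSum_norm_sq (u : L2) : HasSum (fun k => ‖fourierCoeff u k‖ ^ 2) (‖u‖ ^ 2) := by
  have h := (hasSum_inner u u).mapL Complex.reCLM
  have h2 : Complex.reCLM (inner ℂ u u) = ‖u‖ ^ 2 := by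
    rw [inner_self_eq_norm_sq_to_K]; simp [← Complex.ofReal_pow]
  rw [h2] at h
  refine h.congr_fun fun k => ?_
  rw [mul_comm, Complex.mul_conj, Complex.normSq_eq_norm_sq]; simp [-Complex.ofReal_pow]

/-- The function with square summable Fourier coefficients `c`. -/
def ofCoeff (c : ℤ → ℂ) : L2 := ∑' k : ℤ, c k • fourierLp 2 k

theorem fourierCoeff_ofCoeff {c : ℤ → ℂ} (hc : Summable fun k => ‖c k‖ ^ 2) (k : ℤ) :
    fourierCoeff (ofCoeff c) k = c k := by
  have hm : Memℓp c 2 := memℓp_gen (by simpa using hc)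
  have h := (fourierBasis (T := 1)).hasSum_repr_symm (⟨c, hm⟩ : lp (fun _ : ℤ => ℂ) 2)
  simp only [coe_fourierBasis] at h
  have h2 : ofCoeff c = fourierBasis.repr.symm ⟨c, hm⟩ := h.tsum_eq
  rw [h2, ← fourierBasis_repr, LinearIsometryEquiv.apply_symm_apply]

theorem norm_le_of_fourierCoeff_le {u v : L2} {C : ℝ} (hC : 0 ≤ C)
    (h : ∀ k, ‖fourierCoeff u k‖ ≤ C * ‖fourierCoeff v k‖) : ‖u‖ ≤ C * ‖v‖ := by
  refine le_of_sq_le_sq ?_ (by positivity)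
  rw [mul_pow]
  refine hasSum_le (fun k => ?_) (hasSum_norm_sq u) ((hasSum_norm_sq v).mul_left (C ^ 2))
  rw [← mul_pow]
  exact pow_le_pow_left₀ (norm_nonneg _) (h k) 2

/-- Multiplying the Fourier coefficients by a bounded sequence. -/
theorem exists_fourierCoeff_mul (u : L2) {w : ℤ → ℂ} {C : ℝ} (hC : 0 ≤ C)
    (h : ∀ k, fourierCoeff u k ≠ 0 → ‖w k‖ ≤ C) :
    ∃ v : L2, (∀ k, fourierCoeff v k = w k * fourierCoeff u k) ∧ ‖v‖ ≤ C * ‖u‖ := by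
  have h1 : ∀ k, ‖w k * fourierCoeff u k‖ ≤ C * ‖fourierCoeff u k‖ := fun k => by
    by_cases hk : fourierCoeff u k = 0
    · simp [hk]
    · rw [norm_mul]; gcongr; exact h k hk
  have hs : Summable fun k => ‖w k * fourierCoeff u k‖ ^ 2 := by
    refine Summable.of_nonneg_of_le (fun k => by positivity) (fun k => ?_)
      ((hasSum_norm_sq u).summable.mul_left (C ^ 2))
    rw [← mul_pow]
    exact pow_le_pow_left₀ (norm_nonneg _) (h1 k) 2
  refine ⟨ofCoeff fun k => w k * fourierCoeff u k, fourierCoeff_ofCoeff hs, ?_⟩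
  exact norm_le_of_fourierCoeff_le hC fun k => by rw [fourierCoeff_ofCoeff hs]; exact h1 k

/-- A criterion for weighted square summability of the coefficients of a series in `L²`. -/
theorem summable_mul_fourierCoeff_tsum {ι : Type*} {t : ι → L2} (ht : Summable t) {w : ℤ → ℂ}
    {b : ι → ℝ} (hb : Summable b)
    (h : ∀ i, ∃ y : L2, (∀ k, fourierCoeff y k = w k * fourierCoeff (t i) k) ∧ ‖y‖ ≤ b i) :
    Summable fun k => ‖w k * fourierCoeff (∑' i, t i : L2) k‖ ^ 2 := by
  choose y hy hyb using h
  have hys : Summable y := Summable.of_norm_bounded hb hyb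
  refine (hasSum_norm_sq (∑' i, y i)).summable.congr fun k => ?_
  have h1 := hasSum_fourierCoeff hys.hasSum k
  have h2 := (hasSum_fourierCoeff ht.hasSum k).mul_left (w k)
  simp only [hy] at h1
  rw [h1.unique h2]

/-! ### Trigonometric polynomials -/

/-- The trigonometric polynomial with Fourier coefficients `c`. -/
def trig (c : ℤ → ℂ) : C(UnitAddCircle, ℂ) := ∑' k : ℤ, c k • fourier k

theorem trig_eq_sum {c : ℤ → ℂ} {s : Finset ℤ} (hs : ∀ k ∉ s, c k = 0) :
    trig c = ∑ k ∈ s, c k • fourier k := by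
  refine tsum_eq_sum fun k hk => ?_
  ext x
  simp [hs k hk]

theorem trig_apply {c : ℤ → ℂ} {s : Finset ℤ} (hs : ∀ k ∉ s, c k = 0) (x : UnitAddCircle) :
    trig c x = ∑ k ∈ s, c k * fourier k x := by
  rw [trig_eq_sum hs]
  simp

/-- The class in `L²` of a continuous function. -/
abbrev toL2 (F : C(UnitAddCircle, ℂ)) : L2 :=
  ContinuousMap.toLp 2 AddCircle.haarAddCircle ℂ F

theorem norm_toL2_mul_le (F G : C(UnitAddCircle, ℂ)) : ‖toL2 (F * G)‖ ≤ ‖F‖ * ‖toL2 G‖ := by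
  refine Lp.norm_le_mul_norm_of_ae_le_mul ?_
  filter_upwards [ContinuousMap.coeFn_toLp (p := 2) (𝕜 := ℂ) AddCircle.haarAddCircle (F * G),
    ContinuousMap.coeFn_toLp (p := 2) (𝕜 := ℂ) AddCircle.haarAddCircle G] with x h1 h2
  rw [h1, h2]
  simp only [ContinuousMap.coe_mul, Pi.mul_apply, norm_mul]
  gcongr
  exact F.norm_coe_le_norm x

theorem norm_toL2_le (F : C(UnitAddCircle, ℂ)) : ‖toL2 F‖ ≤ ‖F‖ := by
  refine (norm_toL2_mul_le F 1 |>.trans_eq' (by simp)).trans ?_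
  have h1 : (1 : C(UnitAddCircle, ℂ)) = fourier 0 := by
    ext x
    simp
  have : ‖toL2 1‖ = 1 := by
    rw [h1]
    exact orthonormal_fourier.1 0
  rw [this, mul_one]

theorem fourierCoeff_toL2 (F : C(UnitAddCircle, ℂ)) (k : ℤ) :
    fourierCoeff (toL2 F) k = fourierCoeff F k := fourierCoeff_toLp F k

theorem fourierCoeff_fourier_mul (F : UnitAddCircle → ℂ) (l j : ℤ) :
    fourierCoeff (fun x => fourier l x * F x) j = fourierCoeff F (j - l) := by
  unfold fourierCoeff
  congr 1
  ext x
  rw [show -(j - l) = -j + l by ring, fourier_add, smul_eq_mul, smul_eq_mul, mul_assoc]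

theorem fourierCoeff_toL2_trig {c : ℤ → ℂ} {s : Finset ℤ} (hs : ∀ k ∉ s, c k = 0) (k : ℤ) :
    fourierCoeff (toL2 (trig c)) k = c k := by
  rw [trig_eq_sum hs, ← inner_fourierLp]
  simp only [toL2, map_sum, map_smul]
  have : ∀ l, ContinuousMap.toLp 2 AddCircle.haarAddCircle ℂ (fourier l) = fourierLp (T := 1) 2 l :=
    fun l => rfl
  simp only [this, inner_sum, inner_smul_right, orthonormal_iff_ite.1 orthonormal_fourier,
    mul_ite, mul_one, mul_zero, Finset.sum_ite_eq]
  split_ifs with h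
  · rfl
  · rw [hs k h]

theorem norm_toL2_trig_sq {c : ℤ → ℂ} {s : Finset ℤ} (hs : ∀ k ∉ s, c k = 0) :
    ‖toL2 (trig c)‖ ^ 2 = ∑ k ∈ s, ‖c k‖ ^ 2 := by
  refine (hasSum_norm_sq _).unique ?_
  simp only [fourierCoeff_toL2_trig hs]
  exact hasSum_sum_of_ne_finset_zero fun k hk => by simp [hs k hk]

theorem fourierCoeff_toL2_trig_mul {a b : ℤ → ℂ} {s t : Finset ℤ} (hs : ∀ k ∉ s, a k = 0)
    (ht : ∀ k ∉ t, b k = 0) (j : ℤ) :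
    fourierCoeff (toL2 (trig a * trig b)) j = ∑ l ∈ s, a l * b (j - l) := by
  have h : toL2 (trig a * trig b) = ∑ l ∈ s, a l • toL2 (fourier l * trig b) := by
    rw [trig_eq_sum hs, Finset.sum_mul, toL2, map_sum]
    simp only [smul_mul_assoc, map_smul, toL2]
  rw [h, ← inner_fourierLp, inner_sum]
  refine Finset.sum_congr rfl fun l _ => ?_
  rw [inner_smul_right, inner_fourierLp, fourierCoeff_toL2]
  congr 1
  rw [← fourierCoeff_toL2_trig ht, fourierCoeff_toL2]
  exact fourierCoeff_fourier_mul _ _ _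

/-! ### Fourier multipliers on trigonometric polynomials -/

theorem integrable_continuousMap (F : C(UnitAddCircle, ℂ)) :
    Integrable F AddCircle.haarAddCircle :=
  F.continuous.integrable_of_hasCompactSupport (HasCompactSupport.of_compactSpace _)

theorem continuous_integrable_real {F : UnitAddCircle → ℝ} (hF : Continuous F) :
    Integrable F AddCircle.haarAddCircle :=
  hF.integrable_of_hasCompactSupport (HasCompactSupport.of_compactSpace _)

theorem integral_fourier_mul_fourier_sub (j k : ℤ) (x : UnitAddCircle) :
    ∫ y, fourier j y * fourier k (x - y) ∂AddCircle.haarAddCircle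
      = if j = k then fourier k x else 0 := by
  have h1 : ∀ y : UnitAddCircle, (fourier j y * fourier k (x - y) : ℂ)
      = fourier k x * (conj (fourier k y) * fourier j y) := fun y => by
    have : (fourier k (x - y) : ℂ) = fourier k x * conj (fourier k y) := by
      rw [← fourier_neg, sub_eq_add_neg]
      simp only [fourier_apply, smul_add, smul_neg, neg_smul, AddCircle.toCircle_add,
        Circle.coe_mul]
    rw [this]; ring
  have h2 : ∫ y : UnitAddCircle, conj (fourier k y) * fourier j y ∂AddCircle.haarAddCircle
      = if k = j then (1 : ℂ) else 0 := by
    rw [← orthonormal_iff_ite.1 (orthonormal_fourier (T := 1)) k j]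
    rw [ContinuousMap.inner_toLp AddCircle.haarAddCircle (fourier k) (fourier j)]
    congr 1; ext y; ring
  simp only [h1]
  rw [integral_const_mul, h2]
  by_cases h : j = k
  · simp [h]
  · simp [h, Ne.symm h]

/-- A Fourier multiplier is convolution with its kernel `trig a`. Its norm on `L^∞` is therefore at
most the `L¹` norm of the kernel, uniformly in the function it acts on. -/
theorem trig_mul_eq_integral {a c : ℤ → ℂ} {s : Finset ℤ} (ha : ∀ k ∉ s, a k = 0)
    (hc : ∀ k ∉ s, c k = 0) (x : UnitAddCircle) :
    trig (fun k => a k * c k) x = ∫ y, trig a y * trig c (x - y) ∂AddCircle.haarAddCircle := by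
  have h1 : ∀ y, trig a y * trig c (x - y)
      = ∑ j ∈ s, ∑ k ∈ s, a j * c k * (fourier j y * fourier k (x - y)) := fun y => by
    rw [trig_apply ha, trig_apply hc, Finset.sum_mul_sum]
    refine Finset.sum_congr rfl fun j _ => Finset.sum_congr rfl fun k _ => by ring
  simp only [h1]
  have hint : ∀ j k : ℤ, Integrable
      (fun y : UnitAddCircle => a j * c k * (fourier j y * fourier k (x - y) : ℂ))
      AddCircle.haarAddCircle := fun j k =>
    (integrable_continuousMap ⟨fun y => fourier j y * fourier k (x - y), by fun_prop⟩).const_mul _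
  rw [integral_finsetSum _ fun j _ => integrable_finsetSum _ fun k _ => hint j k]
  rw [trig_apply (s := s) (fun k hk => by rw [ha k hk, zero_mul])]
  refine Finset.sum_congr rfl fun j hj => ?_
  rw [integral_finsetSum _ fun k _ => hint j k]
  simp only [integral_const_mul, integral_fourier_mul_fourier_sub, mul_ite, mul_zero,
    Finset.sum_ite_eq, hj, if_true]

theorem norm_trig_mul_le {a c : ℤ → ℂ} {s : Finset ℤ} (ha : ∀ k ∉ s, a k = 0)
    (hc : ∀ k ∉ s, c k = 0) :
    ‖trig (fun k => a k * c k)‖ ≤ (∫ y, ‖trig a y‖ ∂AddCircle.haarAddCircle) * ‖trig c‖ := by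
  have h0 : 0 ≤ ∫ y, ‖trig a y‖ ∂AddCircle.haarAddCircle := integral_nonneg fun _ => norm_nonneg _
  refine (ContinuousMap.norm_le _ (by positivity)).2 fun x => ?_
  rw [trig_mul_eq_integral ha hc, ← integral_mul_const]
  refine norm_integral_le_of_norm_le ((integrable_continuousMap _).norm.mul_const _) ?_
  refine Filter.Eventually.of_forall fun y => ?_
  rw [norm_mul]
  gcongr
  exact (trig c).norm_coe_le_norm _

theorem four_mul_abs_le_norm_fourier_one_sub_one {y : ℝ} (hy : |y| ≤ 1 / 2) :
    4 * |y| ≤ ‖fourier 1 (y : UnitAddCircle) - (1 : ℂ)‖ := by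
  have h1 : ‖fourier 1 (y : UnitAddCircle) - (1 : ℂ)‖ = 2 * |Real.sin (Real.pi * y)| := by
    rw [fourier_coe_apply]
    have := Complex.norm_exp_I_mul_ofReal_sub_one (2 * Real.pi * y)
    rw [show 2 * Real.pi * y / 2 = Real.pi * y by ring] at this
    rw [show 2 * |Real.sin (Real.pi * y)| = ‖2 * Real.sin (Real.pi * y)‖ by
      rw [norm_mul, Real.norm_two, Real.norm_eq_abs], ← this]
    congr 3
    push_cast
    ring
  rw [h1, Real.abs_sin_eq_sin_abs_of_abs_le_pi]
  · have hpi := Real.pi_pos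
    have := Real.mul_le_sin (abs_nonneg (Real.pi * y)) (by
      rw [abs_mul, abs_of_pos hpi]; nlinarith)
    rw [abs_mul, abs_of_pos hpi] at this ⊢
    have h3 : 2 / Real.pi * (Real.pi * |y|) = 2 * |y| := by field_simp
    linarith
  · rw [abs_mul, abs_of_pos Real.pi_pos]; nlinarith [Real.pi_pos]

/-- The chord bound `|e^{2iπy} - 1| ≥ 4|y|` on `[-1/2, 1/2]` reduces the integral to an arctangent,
bounded by `π / 4 < 1`. -/
theorem integral_inv_one_add_le {N : ℝ} (hN : 0 < N) :
    ∫ y : UnitAddCircle, N * (1 + N ^ 2 * ‖fourier 1 y - (1 : ℂ)‖ ^ 2)⁻¹ ∂AddCircle.haarAddCircle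
      ≤ 1 := by
  have hc : Continuous fun y : UnitAddCircle =>
      N * (1 + N ^ 2 * ‖fourier 1 y - (1 : ℂ)‖ ^ 2)⁻¹ := by
    refine continuous_const.mul (Continuous.inv₀ (by fun_prop) fun y => by positivity)
  rw [AddCircle.integral_haarAddCircle, inv_one, one_smul,
    ← AddCircle.intervalIntegral_preimage 1 (-1 / 2)]
  have h1 : ∫ y in (-1 / 2 : ℝ)..(-1 / 2 + 1), N * (1 + (4 * N * y) ^ 2)⁻¹
      = (Real.arctan (2 * N) - Real.arctan (-(2 * N))) / 4 := by
    have := intervalIntegral.integral_comp_mul_left (a := (-1 / 2 : ℝ)) (b := -1 / 2 + 1)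
      (fun x : ℝ => (1 + x ^ 2)⁻¹) (c := 4 * N) (by positivity)
    rw [intervalIntegral.integral_const_mul, this, integral_inv_one_add_sq, smul_eq_mul]
    rw [show 4 * N * (-1 / 2 + 1) = 2 * N by ring, show 4 * N * (-1 / 2) = -(2 * N) by ring]
    field_simp
  have h2 : (Real.arctan (2 * N) - Real.arctan (-(2 * N))) / 4 ≤ 1 := by
    rw [Real.arctan_neg]
    have := Real.arctan_lt_pi_div_two (2 * N)
    have := Real.pi_lt_four
    linarith
  refine le_trans ?_ (h1.trans_le h2)
  refine intervalIntegral.integral_mono_on (by norm_num) ?_ ?_ fun y hy => ?_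
  · exact (hc.comp (AddCircle.continuous_mk' 1)).intervalIntegrable _ _
  · refine Continuous.intervalIntegrable ?_ _ _
    exact continuous_const.mul (Continuous.inv₀ (by fun_prop) fun y => by positivity)
  · have hy' : |y| ≤ 1 / 2 := abs_le.2 ⟨by linarith [hy.1], by linarith [hy.2]⟩
    have := four_mul_abs_le_norm_fourier_one_sub_one hy'
    have h3 : (4 * N * y) ^ 2 ≤ N ^ 2 * ‖fourier 1 (y : UnitAddCircle) - (1 : ℂ)‖ ^ 2 := by
      calc (4 * N * y) ^ 2 = N ^ 2 * (4 * |y|) ^ 2 := by rw [mul_pow 4 |y|, sq_abs]; ring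
        _ ≤ _ := by gcongr
    gcongr

theorem integral_norm_sq (F : C(UnitAddCircle, ℂ)) :
    ∫ y, ‖F y‖ ^ 2 ∂AddCircle.haarAddCircle = ‖toL2 F‖ ^ 2 := by
  have h : (inner ℂ (toL2 F) (toL2 F) : ℂ) = ((‖toL2 F‖ ^ 2 : ℝ) : ℂ) := by
    rw [inner_self_eq_norm_sq_to_K]; simp
  rw [ContinuousMap.inner_toLp] at h
  rw [← Complex.ofReal_inj, ← h, ← integral_complex_ofReal]
  congr 1
  ext y
  rw [Complex.mul_conj, Complex.normSq_eq_norm_sq]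

/-- The `L¹` norm of a trigonometric polynomial. -/
theorem integral_norm_trig_le {a : ℤ → ℂ} {s : Finset ℤ} (ha : ∀ k ∉ s, a k = 0)
    (hb : ∀ k ∉ s, a (k - 1) - a k = 0) {N : ℝ} (hN : 0 < N) :
    ∫ y, ‖trig a y‖ ∂AddCircle.haarAddCircle
      ≤ N⁻¹ * ((∑ k ∈ s, ‖a k‖ ^ 2) + N ^ 2 * ∑ k ∈ s, ‖a (k - 1) - a k‖ ^ 2) + 1 := by
  -- The weight is of size one where `|y| ≲ 1/N`. Weighted AM-GM gives `t ≤ N⁻¹ t² w + N w⁻¹`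
  -- pointwise. The second term has integral at most one. Multiplication by `e_1 - 1` takes
  -- differences of the coefficients, so Parseval evaluates the first.
  set w : UnitAddCircle → ℝ := fun y => 1 + N ^ 2 * ‖fourier 1 y - (1 : ℂ)‖ ^ 2 with hw
  have hwp : ∀ y, 0 < w y := fun y => by positivity
  have hwc : Continuous w := by fun_prop
  have h1 : ∀ y, ‖trig a y‖ ≤ N⁻¹ * (‖trig a y‖ ^ 2 + N ^ 2 * ‖trig (fun k => a (k - 1) - a k) y‖ ^ 2)
      + N * (w y)⁻¹ := fun y => by
    have h2 : trig (fun k => a (k - 1) - a k) y = (fourier 1 y - 1) * trig a y := by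
      have hs' : ∀ k ∉ s.image (· + 1), a (k - 1) = 0 := fun k hk => ha _ fun h =>
        hk (Finset.mem_image.2 ⟨k - 1, h, by ring⟩)
      have hu1 : ∀ k ∉ s ∪ s.image (· + 1), a (k - 1) = 0 := fun k hk =>
        hs' k fun h => hk (Finset.mem_union_right _ h)
      have hu2 : ∀ k ∉ s ∪ s.image (· + 1), a k = 0 := fun k hk =>
        ha k fun h => hk (Finset.mem_union_left _ h)
      rw [trig_apply (s := s ∪ s.image (· + 1)) (fun k hk => by rw [hu1 k hk, hu2 k hk, sub_zero])]
      simp only [sub_mul, Finset.sum_sub_distrib, one_mul]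
      rw [← trig_apply hu2, ← trig_apply hu1, trig_apply hs', trig_apply ha, Finset.sum_image
        (fun x _ y _ h => by simpa using h), Finset.mul_sum]
      congr 1
      refine Finset.sum_congr rfl fun k _ => ?_
      rw [add_sub_cancel_right, fourier_add]
      ring
    rw [h2, norm_mul, mul_pow]
    have h3 : ‖trig a y‖ ^ 2 + N ^ 2 * (‖fourier 1 y - (1 : ℂ)‖ ^ 2 * ‖trig a y‖ ^ 2)
        = ‖trig a y‖ ^ 2 * w y := by rw [hw]; ring
    rw [h3]
    set t := ‖trig a y‖
    have h4 := hwp y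
    set q := w y
    have h5 : N⁻¹ * (t ^ 2 * q) + N * q⁻¹ - t = N⁻¹ * q⁻¹ * ((t * q - N) ^ 2 + t * q * N) := by
      field_simp
      ring
    have : 0 ≤ N⁻¹ * q⁻¹ * ((t * q - N) ^ 2 + t * q * N) := by positivity
    linarith
  have hi2 : Continuous fun y => ‖trig a y‖ ^ 2 + N ^ 2 * ‖trig (fun k => a (k - 1) - a k) y‖ ^ 2 := by
    fun_prop
  have hi3 : Continuous fun y => N * (w y)⁻¹ :=
    continuous_const.mul (hwc.inv₀ fun y => (hwp y).ne')
  have hi4 := continuous_integrable_real (F := fun y => N⁻¹ *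
    (‖trig a y‖ ^ 2 + N ^ 2 * ‖trig (fun k => a (k - 1) - a k) y‖ ^ 2)) (by fun_prop)
  refine (integral_mono (integrable_continuousMap _).norm
    (hi4.add (continuous_integrable_real hi3)) h1).trans ?_
  simp only [Pi.add_apply]
  rw [integral_add hi4 (continuous_integrable_real hi3), integral_const_mul, integral_add
    (continuous_integrable_real (by fun_prop)) (continuous_integrable_real (by fun_prop)),
    integral_const_mul, integral_norm_sq, integral_norm_sq, norm_toL2_trig_sq ha,
    norm_toL2_trig_sq hb]
  gcongr
  exact integral_inv_one_add_le hN

/-- Lipschitz compactly supported multipliers are bounded on `L^∞`, uniformly in the scale. -/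
theorem exists_norm_trig_multiplier_le {G : ℝ → ℝ} {K : NNReal} (hG : LipschitzWith K G) {R : ℝ}
    (hR : ∀ z, R < |z| → G z = 0) :
    ∃ C : ℝ, 0 ≤ C ∧ ∀ N : ℝ, 1 ≤ N → ∀ (c : ℤ → ℂ) (t : Finset ℤ), (∀ k ∉ t, c k = 0) →
      ‖trig (fun k => (G (k / N) : ℂ) * c k)‖ ≤ C * ‖trig c‖ := by
  obtain ⟨M, hM⟩ : ∃ M, ∀ z, |G z| ≤ M := by
    have : HasCompactSupport G := HasCompactSupport.intro (isCompact_closedBall (0 : ℝ) R)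
      fun z hz => hR z (by simpa using hz)
    obtain ⟨M, hM⟩ := this.exists_bound_of_continuous hG.continuous
    exact ⟨M, hM⟩
  have hM0 : 0 ≤ M := (abs_nonneg _).trans (hM 0)
  -- About `N` frequencies are active, each contributing at most `M²`, and the differences are at
  -- most `K / N`. The powers of `N` cancel, which makes the constant uniform in the scale.
  refine ⟨(2 * |R| + 5) * (M ^ 2 + K ^ 2) + 1, by positivity, fun N hN c t hc => ?_⟩
  have hN0 : 0 < N := by linarith
  set B : ℤ := ⌈|R| * N⌉ with hB
  have hB0 : 0 ≤ B := Int.ceil_nonneg (by positivity)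
  have hBle : (B : ℝ) ≤ |R| * N + 1 := (Int.ceil_lt_add_one _).le
  -- The margin of one lets the same set carry both the coefficients and their shift by one.
  set s := Finset.Icc (-(B + 1)) (B + 1) with hs
  have ha0 : ∀ k : ℤ, B < |k| → G (k / N) = 0 := fun k hk => by
    apply hR
    rw [abs_div, abs_of_pos hN0, lt_div_iff₀ hN0]
    have h1 : (B : ℝ) < |(k : ℝ)| := by exact_mod_cast hk
    have h2 : |R| * N ≤ B := Int.le_ceil _
    have h3 : R * N ≤ |R| * N := by gcongr; exact le_abs_self R
    linarith
  have hmem : ∀ k ∉ s, B + 1 < |k| := fun k hk => by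
    rw [hs, Finset.mem_Icc] at hk
    rw [lt_abs]
    omega
  have ha : ∀ k ∉ s, ((G (k / N) : ℝ) : ℂ) = 0 := fun k hk => by
    rw [ha0 k (by linarith [hmem k hk]), Complex.ofReal_zero]
  have hb : ∀ k ∉ s, ((G ((k - 1 : ℤ) / N) : ℝ) : ℂ) - ((G (k / N) : ℝ) : ℂ) = 0 := fun k hk => by
    rw [ha k hk, ha0 (k - 1), Complex.ofReal_zero, sub_zero]
    have := hmem k hk
    have := abs_sub_abs_le_abs_sub k 1
    rw [abs_one] at this
    linarith
  have h1 := norm_trig_mul_le (s := s ∪ t) (a := fun k : ℤ => ((G (k / N) : ℝ) : ℂ)) (c := c)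
    (fun k hk => ha k fun h => hk (Finset.mem_union_left _ h))
    (fun k hk => hc k fun h => hk (Finset.mem_union_right _ h))
  refine h1.trans (mul_le_mul_of_nonneg_right ?_ (norm_nonneg _))
  refine (integral_norm_trig_le ha hb hN0).trans (add_le_add ?_ le_rfl)
  have hcard : (s.card : ℝ) ≤ (2 * |R| + 5) * N := by
    rw [hs, Int.card_Icc]
    have : ((B + 1 + 1 - (-(B + 1))).toNat : ℤ) = 2 * B + 3 := by
      rw [Int.toNat_of_nonneg (by linarith)]; ring
    have h2 : (((B + 1 + 1 - (-(B + 1))).toNat : ℤ) : ℝ) = 2 * B + 3 := by rw [this]; push_cast; rfl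
    rw [Int.cast_natCast] at h2
    rw [h2]
    linarith
  have hs1 : ∑ k ∈ s, ‖((G (k / N) : ℝ) : ℂ)‖ ^ 2 ≤ s.card * M ^ 2 := by
    rw [← nsmul_eq_mul]
    refine Finset.sum_le_card_nsmul _ _ _ fun k _ => ?_
    rw [Complex.norm_real]
    exact pow_le_pow_left₀ (norm_nonneg _) (hM _) 2
  have hs2 : ∑ k ∈ s, ‖((G ((k - 1 : ℤ) / N) : ℝ) : ℂ) - ((G (k / N) : ℝ) : ℂ)‖ ^ 2
      ≤ s.card * (K / N) ^ 2 := by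
    rw [← nsmul_eq_mul]
    refine Finset.sum_le_card_nsmul _ _ _ fun k _ => ?_
    rw [← Complex.ofReal_sub, Complex.norm_real]
    refine pow_le_pow_left₀ (norm_nonneg _) ?_ 2
    have := hG.dist_le_mul ((k - 1 : ℤ) / N : ℝ) (k / N)
    rw [Real.dist_eq, Real.dist_eq] at this
    have h4 : |((k - 1 : ℤ) : ℝ) / N - k / N| = 1 / N := by
      rw [← sub_div, abs_div, abs_of_pos hN0]
      push_cast
      simp
    rw [h4] at this
    simpa [div_eq_mul_inv] using this
  calc N⁻¹ * ((∑ k ∈ s, ‖((G (k / N) : ℝ) : ℂ)‖ ^ 2)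
        + N ^ 2 * ∑ k ∈ s, ‖((G ((k - 1 : ℤ) / N) : ℝ) : ℂ) - ((G (k / N) : ℝ) : ℂ)‖ ^ 2)
      ≤ N⁻¹ * (s.card * M ^ 2 + N ^ 2 * (s.card * (K / N) ^ 2)) := by gcongr
    _ = N⁻¹ * s.card * (M ^ 2 + K ^ 2) := by field_simp
    _ ≤ N⁻¹ * ((2 * |R| + 5) * N) * (M ^ 2 + K ^ 2) := by gcongr
    _ = (2 * |R| + 5) * (M ^ 2 + K ^ 2) := by field_simp

/-! ### Dyadic partitions of unity -/

/-- A single constant encodes size and frequency localisation of all blocks. The low block `0` has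
no lower frequency bound. Block `n + 1` lives at scale `2 ^ n`; the discrepancy of a factor `2` is
absorbed by `2 / r`. -/
theorem DyadicPartition.exists_cutoff_bounds (D : DyadicPartition) :
    ∃ A : ℝ, 1 ≤ A ∧ (∀ n z, |D.cutoff n z| ≤ A) ∧
      (∀ n z, D.cutoff n z ≠ 0 → |z| ≤ A * 2 ^ n) ∧
      (∀ n z, D.cutoff (n + 1) z ≠ 0 → 2 ^ (n + 1) ≤ A * |z|) := by
  obtain ⟨R₀, h₀⟩ := D.support_χ
  obtain ⟨r, R, hr, h₁⟩ := D.support_ρ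
  have hχ : ∀ z, D.χ z ≠ 0 → |z| ≤ R₀ := fun z hz => h₀ (subset_tsupport _ hz)
  have hρ : ∀ z, D.ρ z ≠ 0 → r ≤ |z| ∧ |z| ≤ R := fun z hz => h₁ (subset_tsupport _ hz)
  have bound : ∀ {f : ℝ → ℝ} {S : ℝ}, Continuous f → (∀ z, f z ≠ 0 → |z| ≤ S) →
      ∃ M, ∀ z, |f z| ≤ M := fun {f S} hf hS => by
    have : HasCompactSupport f := HasCompactSupport.intro (isCompact_closedBall (0 : ℝ) S)
      fun z hz => by
        by_contra h
        exact hz (by simpa using hS z h)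
    obtain ⟨M, hM⟩ := this.exists_bound_of_continuous hf
    exact ⟨M, hM⟩
  obtain ⟨M₀, hM₀⟩ := bound D.smooth_χ.continuous hχ
  obtain ⟨M₁, hM₁⟩ := bound D.smooth_ρ.continuous fun z hz => (hρ z hz).2
  set A := 1 + |R₀| + |R| + 2 / r + |M₀| + |M₁| with hA
  have a₀ := abs_nonneg R₀
  have a₁ := abs_nonneg R
  have a₂ := abs_nonneg M₀
  have a₃ := abs_nonneg M₁
  have a₄ : 0 < 2 / r := by positivity
  refine ⟨A, by linarith, fun n z => ?_, fun n z hz => ?_, fun n z hz => ?_⟩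
  · cases n with
    | zero => exact (hM₀ z).trans (by linarith [le_abs_self M₀])
    | succ n => exact (hM₁ _).trans (by linarith [le_abs_self M₁])
  · cases n with
    | zero => have := hχ z hz; simp only [pow_zero, mul_one]; linarith [le_abs_self R₀]
    | succ n =>
      have := (hρ _ hz).2
      rw [abs_div, abs_of_pos (by positivity : (0 : ℝ) < 2 ^ n), div_le_iff₀ (by positivity)] at this
      refine this.trans ?_
      have h2 : (2 : ℝ) ^ n ≤ 2 ^ (n + 1) := pow_le_pow_right₀ (by norm_num) (by omega)
      have : R ≤ A := by linarith [le_abs_self R]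
      gcongr
  · have := (hρ _ hz).1
    rw [abs_div, abs_of_pos (by positivity : (0 : ℝ) < 2 ^ n), le_div_iff₀ (by positivity)] at this
    calc (2 : ℝ) ^ (n + 1) = 2 / r * (r * 2 ^ n) := by field_simp; ring
      _ ≤ 2 / r * |z| := by gcongr
      _ ≤ A * |z| := by gcongr; linarith

theorem DyadicPartition.exists_finset (D : DyadicPartition) (n : ℕ) :
    ∃ s : Finset ℤ, ∀ k ∉ s, D.cutoff n (k : ℝ) = 0 := by
  obtain ⟨A, -, -, h, -⟩ := D.exists_cutoff_bounds
  refine ⟨Finset.Icc (-⌈A * 2 ^ n⌉) ⌈A * 2 ^ n⌉, fun k hk => ?_⟩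
  by_contra h0
  have h1 := (h n k h0).trans (Int.le_ceil _)
  rw [Finset.mem_Icc, ← abs_le] at hk
  exact hk (by exact_mod_cast h1)

theorem DyadicPartition.hasSum_cutoff (D : DyadicPartition) (z : ℝ) :
    HasSum (fun n => D.cutoff n z) 1 := by
  rw [← hasSum_nat_add_iff' 1]
  simpa [DyadicPartition.cutoff] using D.sum_eq_one z

theorem DyadicPartition.cutoff_mul_cutoff (D : DyadicPartition) {i j : ℕ} (h : i + 1 < j) (z : ℝ) :
    D.cutoff i z = 0 ∨ D.cutoff j z = 0 := by
  have key : ∀ {f g : ℝ → ℝ}, Disjoint (tsupport f) (tsupport g) → f z = 0 ∨ g z = 0 :=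
    fun {f g} hd => by
      by_contra! hne
      exact Set.disjoint_left.1 hd (subset_tsupport _ hne.1) (subset_tsupport _ hne.2)
  obtain ⟨j, rfl⟩ : ∃ j', j = j' + 1 := ⟨j - 1, by omega⟩
  cases i with
  | zero => exact key (D.disjoint_χ_ρ j (by omega))
  | succ i => exact key (D.disjoint_ρ_ρ i j (by omega))

/-- At each point at most two consecutive cutoffs are nonzero: the first nonvanishing one excludes
all beyond its successor. -/
theorem DyadicPartition.summable_abs_cutoff (D : DyadicPartition) {A : ℝ}
    (hA : ∀ n z, |D.cutoff n z| ≤ A) (z : ℝ) :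
    Summable (fun n => |D.cutoff n z|) ∧ ∑' n, |D.cutoff n z| ≤ 2 * A := by
  have hA0 : 0 ≤ A := (abs_nonneg _).trans (hA 0 0)
  obtain ⟨n₀, hn₀⟩ : ∃ n₀, ∀ n ∉ ({n₀, n₀ + 1} : Finset ℕ), D.cutoff n z = 0 := by
    by_cases h : ∃ n, D.cutoff n z ≠ 0
    · classical
      refine ⟨Nat.find h, fun n hn => ?_⟩
      simp only [Finset.mem_insert, Finset.mem_singleton, not_or] at hn
      rcases lt_or_ge n (Nat.find h) with h1 | h1
      · exact not_not.1 (Nat.find_min h h1)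
      · exact (D.cutoff_mul_cutoff (i := Nat.find h) (j := n) (by omega) z).resolve_left
          (Nat.find_spec h)
    · push Not at h
      exact ⟨0, fun n _ => h n⟩
  have hs : HasSum (fun n => |D.cutoff n z|) (∑ n ∈ ({n₀, n₀ + 1} : Finset ℕ), |D.cutoff n z|) :=
    hasSum_sum_of_ne_finset_zero fun n hn => by rw [hn₀ n hn, abs_zero]
  refine ⟨hs.summable, ?_⟩
  rw [hs.tsum_eq, Finset.sum_pair (by omega)]
  linarith [hA n₀ z, hA (n₀ + 1) z]

/-! ### Bernstein inequalities -/

/-- The function `z ↦ z^{-a}` is truncated smoothly away from the annulus. On a block it then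
agrees, after rescaling, with a multiplier to which `exists_norm_trig_multiplier_le` applies. -/
theorem exists_lipschitz_inv_pow {r : ℝ} (hr : 0 < r) (R : ℝ) (a : ℕ) :
    ∃ (G : ℝ → ℝ) (K : NNReal) (S : ℝ), LipschitzWith K G ∧ (∀ z, S < |z| → G z = 0) ∧
      ∀ z, r ≤ |z| → |z| ≤ R → G z = (z ^ a)⁻¹ := by
  set θ : ℝ → ℝ := fun z => Real.smoothTransition ((4 * z ^ 2 - r ^ 2) / (3 * r ^ 2)) *
    Real.smoothTransition (R ^ 2 + 1 - z ^ 2) with hθ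
  have hθc : ContDiff ℝ 1 θ := by
    refine ContDiff.mul ?_ ?_
    · exact Real.smoothTransition.contDiff.comp (by fun_prop)
    · exact Real.smoothTransition.contDiff.comp (by fun_prop)
  have h0 : ∀ z, |z| < r / 2 → θ z = 0 := fun z hz => by
    have : (4 * z ^ 2 - r ^ 2) / (3 * r ^ 2) ≤ 0 := by
      refine div_nonpos_of_nonpos_of_nonneg ?_ (by positivity)
      nlinarith [sq_abs z, abs_nonneg z]
    simp [hθ, Real.smoothTransition.zero_of_nonpos this]
  have hS : ∀ z, |R| + 1 < |z| → θ z = 0 := fun z hz => by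
    have : R ^ 2 + 1 - z ^ 2 ≤ 0 := by nlinarith [sq_abs z, sq_abs R, abs_nonneg R]
    simp [hθ, Real.smoothTransition.zero_of_nonpos this]
  have hGc : ContDiff ℝ 1 fun z => θ z * (z ^ a)⁻¹ := by
    rw [contDiff_iff_contDiffAt]
    intro z
    -- At the singularity of `z^{-a}` the truncation vanishes on a whole neighbourhood.
    by_cases hz : z = 0
    · have : (fun z => θ z * (z ^ a)⁻¹) =ᶠ[nhds z] fun _ => 0 := by
        have hb : Metric.ball (0 : ℝ) (r / 2) ∈ nhds z := by
          rw [hz]; exact Metric.ball_mem_nhds _ (by positivity)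
        filter_upwards [hb] with y hy
        rw [h0 y (by simpa using hy), zero_mul]
      exact contDiffAt_const.congr_of_eventuallyEq this
    · exact hθc.contDiffAt.mul ((contDiffAt_id.pow a).inv (pow_ne_zero _ hz))
  have hcs : HasCompactSupport fun z => θ z * (z ^ a)⁻¹ :=
    HasCompactSupport.intro (isCompact_closedBall (0 : ℝ) (|R| + 1)) fun z hz => by
      rw [hS z (by simpa using hz), zero_mul]
  obtain ⟨K, hK⟩ := hGc.lipschitzWith_of_hasCompactSupport hcs one_ne_zero
  refine ⟨_, K, |R| + 1, hK, fun z hz => by rw [hS z hz, zero_mul], fun z h1 h2 => ?_⟩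
  have e1 : 1 ≤ (4 * z ^ 2 - r ^ 2) / (3 * r ^ 2) := by
    rw [le_div_iff₀ (by positivity)]
    nlinarith [sq_abs z]
  have e2 : 1 ≤ R ^ 2 + 1 - z ^ 2 := by nlinarith [sq_abs z, abs_nonneg z]
  simp [hθ, Real.smoothTransition.one_of_one_le e1, Real.smoothTransition.one_of_one_le e2]

theorem trig_const_mul (x : ℂ) {c : ℤ → ℂ} {s : Finset ℤ} (hs : ∀ k ∉ s, c k = 0) :
    trig (fun k => x * c k) = x • trig c := by
  rw [trig_eq_sum hs, trig_eq_sum (s := s) (fun k hk => by rw [hs k hk, mul_zero]),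
    Finset.smul_sum]
  simp only [mul_smul]

/-- This is the inverse Bernstein inequality: integrating `a` times on an annulus of size `2 ^ m`
gains `2 ^ (-a m)` in `L^∞`. On the support of the cutoff, `k^{-a} = 2^{-am} G(k / 2^m)`. -/
theorem exists_norm_trig_cutoff_div_le (D : DyadicPartition) (a : ℕ) :
    ∃ C : ℝ, 0 ≤ C ∧ ∀ (m : ℕ) (c : ℤ → ℂ),
      ‖trig fun k => (D.cutoff (m + 1) (k : ℝ) : ℂ) * (c k / (k : ℂ) ^ a)‖
        ≤ C * ((2 ^ m) ^ a)⁻¹ * ‖block D (m + 1) c‖ := by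
  obtain ⟨r, R, hr, h₁⟩ := D.support_ρ
  obtain ⟨G, K, S, hG, hS, hGe⟩ := exists_lipschitz_inv_pow hr R a
  obtain ⟨C, hC, hCb⟩ := exists_norm_trig_multiplier_le hG hS
  refine ⟨C, hC, fun m c => ?_⟩
  obtain ⟨s, hs⟩ := D.exists_finset (m + 1)
  have hs' : ∀ k ∉ s, ((D.cutoff (m + 1) (k : ℝ) : ℂ) * c k) = 0 := fun k hk => by
    rw [hs k hk, Complex.ofReal_zero, zero_mul]
  have e : (fun k : ℤ => (D.cutoff (m + 1) (k : ℝ) : ℂ) * (c k / (k : ℂ) ^ a))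
      = fun k : ℤ => ((((2 ^ m) ^ a)⁻¹ : ℝ) : ℂ) *
        ((G (k / 2 ^ m) : ℂ) * ((D.cutoff (m + 1) (k : ℝ) : ℂ) * c k)) := by
    ext k
    by_cases hk : D.cutoff (m + 1) (k : ℝ) = 0
    · simp [hk]
    · have h2 := h₁ (subset_tsupport _ hk)
      rw [hGe _ h2.1 h2.2]
      push_cast
      rw [div_pow, inv_div]
      have : ((2 : ℂ) ^ m) ^ a ≠ 0 := pow_ne_zero _ (pow_ne_zero _ two_ne_zero)
      field_simp
  rw [e, trig_const_mul (s := s) _ (fun k hk => by rw [hs' k hk, mul_zero]), norm_smul,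
    Complex.norm_real, Real.norm_of_nonneg (by positivity)]
  have h3 := hCb (2 ^ m) (one_le_pow₀ (by norm_num)) _ s hs'
  calc _ ≤ ((2 ^ m) ^ a)⁻¹ * (C * ‖block D (m + 1) c‖) := by gcongr; exact h3
    _ = _ := by ring

theorem MemHolderBesov.exists_block_le {D : DyadicPartition} {κ : ℝ} {c : ℤ → ℂ}
    (h : MemHolderBesov D (-1 + κ) c) :
    ∃ C : ℝ, 0 ≤ C ∧ ∀ m, ‖block D m c‖ ≤ C * (2 ^ m * ((2 : ℝ) ^ (-κ)) ^ m) := by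
  obtain ⟨C, hC⟩ := h
  have h2 : (0 : ℝ) < 2 := by norm_num
  have hC0 : 0 ≤ C := le_trans (by positivity) (hC 0)
  -- The factor `2 ^ (-1 + κ)` undoes the shift between the index `m` and the exponent `m - 1`.
  refine ⟨C * 2 ^ (-1 + κ), by positivity, fun m => ?_⟩
  have e1 : (2 : ℝ) ^ m * ((2 : ℝ) ^ (-κ)) ^ m = 2 ^ ((1 - κ) * m) := by
    rw [← Real.rpow_natCast, ← Real.rpow_natCast, ← Real.rpow_mul h2.le, ← Real.rpow_add h2]
    ring_nf
  have h3 := hC m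
  rw [e1, mul_assoc, ← Real.rpow_add h2]
  calc ‖block D m c‖
      = (2 : ℝ) ^ ((-1 + κ) * ((m : ℝ) - 1)) * ‖block D m c‖
          * 2 ^ (-1 + κ + (1 - κ) * m) := by
        rw [mul_right_comm, ← Real.rpow_add h2,
          show (-1 + κ) * ((m : ℝ) - 1) + (-1 + κ + (1 - κ) * m) = 0 by ring, Real.rpow_zero,
          one_mul]
    _ ≤ C * 2 ^ (-1 + κ + (1 - κ) * m) := by gcongr

/-- Distributions of regularity larger than `-1` are in `H^{-1}`. -/
theorem summable_div_one_add_abs {D : DyadicPartition} {c : ℤ → ℂ} {C q : ℝ} (hq0 : 0 ≤ q)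
    (hq1 : q < 1) (h : ∀ m, ‖block D m c‖ ≤ C * (2 ^ m * q ^ m)) :
    Summable fun k : ℤ => (‖c k‖ / (1 + |(k : ℝ)|)) ^ 2 := by
  obtain ⟨A, hA1, hA, hA2, hA3⟩ := D.exists_cutoff_bounds
  have hlow : ∀ n (k : ℤ), D.cutoff n k ≠ 0 → 2 ^ n ≤ A * (1 + |(k : ℝ)|) := fun n k hk => by
    have := abs_nonneg (k : ℝ)
    cases n with
    | zero => nlinarith
    | succ n => have := hA3 n k hk; nlinarith
  -- On block `m` the weight satisfies `1 + |k| ≥ 2^m / A`, so dividing by it cancels the growth `2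
  -- ^ m` and leaves the summable `q ^ m`. The blocks recombine because the cutoffs sum to one.
  have hy : ∀ m, ∃ y : L2, (∀ k : ℤ, fourierCoeff y k
      = (D.cutoff m k : ℂ) * (c k / ((1 + |(k : ℝ)| : ℝ) : ℂ))) ∧ ‖y‖ ≤ A * C * q ^ m := fun m => by
    obtain ⟨s, hs⟩ := D.exists_finset m
    have hs' : ∀ k ∉ s, ((D.cutoff m (k : ℝ) : ℂ) * c k) = 0 := fun k hk => by
      rw [hs k hk, Complex.ofReal_zero, zero_mul]
    obtain ⟨y, hy1, hy2⟩ := exists_fourierCoeff_mul (toL2 (block D m c))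
      (w := fun k : ℤ => ((1 + |(k : ℝ)| : ℝ) : ℂ)⁻¹) (C := A / 2 ^ m) (by positivity)
      fun k hk => by
        have hk' : D.cutoff m k ≠ 0 := fun h0 => hk (by
          rw [block, ← trig, fourierCoeff_toL2_trig hs', h0, Complex.ofReal_zero, zero_mul])
        rw [norm_inv, Complex.norm_real, Real.norm_of_nonneg (by positivity),
          inv_le_comm₀ (by positivity) (by positivity), inv_div, div_le_iff₀ (by positivity)]
        linarith [hlow m k hk']
    refine ⟨y, fun k => ?_, ?_⟩
    · rw [hy1, block, ← trig, fourierCoeff_toL2_trig hs']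
      ring
    · refine hy2.trans ?_
      calc A / 2 ^ m * ‖toL2 (block D m c)‖ ≤ A / 2 ^ m * (C * (2 ^ m * q ^ m)) := by
            gcongr
            exact (norm_toL2_le _).trans (h m)
        _ = A * C * q ^ m := by field_simp
  choose y hy1 hy2 using hy
  have hsum : Summable y :=
    Summable.of_norm_bounded ((summable_geometric_of_lt_one hq0 hq1).mul_left (A * C)) hy2
  refine (hasSum_norm_sq (∑' m, y m)).summable.congr fun k => ?_
  have h1 := hasSum_fourierCoeff hsum.hasSum k
  simp only [hy1] at h1
  have h2 := ((D.hasSum_cutoff k).mapL Complex.ofRealCLM).mul_right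
    (c k / ((1 + |(k : ℝ)| : ℝ) : ℂ))
  simp only [Complex.ofRealCLM_apply] at h2
  rw [h1.unique h2, Complex.ofReal_one, one_mul, norm_div, Complex.norm_real,
    Real.norm_of_nonneg (by positivity)]

/-! ### Discrete inequalities -/

theorem summable_mul_and_tsum_le {f g : ℤ → ℝ} (hf : ∀ k, 0 ≤ f k) (hg : ∀ k, 0 ≤ g k)
    (hf2 : Summable fun k => f k ^ 2) (hg2 : Summable fun k => g k ^ 2) :
    Summable (fun k => f k * g k) ∧
      ∑' k, f k * g k ≤ √(∑' k, f k ^ 2) * √(∑' k, g k ^ 2) := by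
  have h := Real.summable_and_inner_le_Lp_mul_Lq_tsum_of_nonneg (f := f) (g := g) Real.HolderConjugate.two_two
    hf hg (by simpa using hf2) (by simpa using hg2)
  simpa [Real.sqrt_eq_rpow] using h

/-- Young's inequality for a trilinear sum. -/
theorem summable_trilinear {W f g : ℤ → ℝ} (hW : ∀ k, 0 ≤ W k) (hf : ∀ k, 0 ≤ f k)
    (hg : ∀ k, 0 ≤ g k) (hW2 : Summable fun k => W k ^ 2) (hf2 : Summable fun k => f k ^ 2)
    (hg1 : Summable g) :
    Summable (fun p : ℤ × ℤ => W (p.2 - p.1) * f p.2 * g p.1) ∧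
      ∑' p : ℤ × ℤ, W (p.2 - p.1) * f p.2 * g p.1
        ≤ √(∑' k, W k ^ 2) * √(∑' k, f k ^ 2) * ∑' k, g k := by
  have hWl : ∀ l : ℤ, Summable (fun j : ℤ => W (j - l) ^ 2) := fun l =>
    hW2.comp_injective (i := fun j : ℤ => j - l) sub_left_injective
  have hWe : ∀ l : ℤ, ∑' j : ℤ, W (j - l) ^ 2 = ∑' k, W k ^ 2 := fun l =>
    (Equiv.subRight l).tsum_eq fun k => W k ^ 2
  -- Cauchy-Schwarz in `j` for each fixed `l`, where translation does not change the `ℓ²` norm of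
  -- `W`; the `ℓ¹` sequence `g` then handles the sum over `l`.
  have h1 : ∀ l : ℤ, _ := fun l => summable_mul_and_tsum_le (fun j : ℤ => hW (j - l)) hf (hWl l) hf2
  simp only [hWe] at h1
  have h2 : ∀ l, ∑' j, W (j - l) * f j * g l
      ≤ √(∑' k, W k ^ 2) * √(∑' k, f k ^ 2) * g l := fun l => by
    rw [tsum_mul_right]
    exact mul_le_mul_of_nonneg_right (h1 l).2 (hg l)
  have h0 : ∀ p : ℤ × ℤ, 0 ≤ W (p.2 - p.1) * f p.2 * g p.1 := fun p =>
    mul_nonneg (mul_nonneg (hW _) (hf _)) (hg _)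
  have h3 : Summable fun l => ∑' j, W (j - l) * f j * g l :=
    Summable.of_nonneg_of_le (fun l => tsum_nonneg fun j => h0 (l, j)) h2 (hg1.mul_left _)
  have h4 : Summable (fun p : ℤ × ℤ => W (p.2 - p.1) * f p.2 * g p.1) :=
    (summable_prod_of_nonneg h0).2 ⟨fun l => (h1 l).1.mul_right (g l), h3⟩
  refine ⟨h4, ?_⟩
  rw [h4.tsum_prod, ← tsum_mul_left]
  exact h3.tsum_le_tsum h2 (hg1.mul_left _)

/-- The form of a potential in `H^{-1}` is bounded on a weighted `H^1`. -/
theorem summable_potential_form {v : ℤ → ℂ} {Λ f g : ℤ → ℝ}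
    (hv : Summable fun k : ℤ => (‖v k‖ / (1 + |(k : ℝ)|)) ^ 2)
    (hΛ : ∀ k : ℤ, 1 + |(k : ℝ)| ≤ Λ k) (hΛs : Summable fun k => (Λ k)⁻¹ ^ 2)
    (hf : ∀ k, 0 ≤ f k) (hg : ∀ k, 0 ≤ g k)
    (hf2 : Summable fun k => f k ^ 2) (hg2 : Summable fun k => g k ^ 2) :
    Summable (fun p : ℤ × ℤ => ‖v (p.2 - p.1)‖ * (f p.1 / Λ p.1) * (g p.2 / Λ p.2)) ∧
      ∑' p : ℤ × ℤ, ‖v (p.2 - p.1)‖ * (f p.1 / Λ p.1) * (g p.2 / Λ p.2)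
        ≤ 2 * √(∑' k : ℤ, (‖v k‖ / (1 + |(k : ℝ)|)) ^ 2) * √(∑' k, (Λ k)⁻¹ ^ 2)
          * √(∑' k, f k ^ 2) * √(∑' k, g k ^ 2) := by
  set W : ℤ → ℝ := fun k => ‖v k‖ / (1 + |(k : ℝ)|) with hWdef
  have hΛ0 : ∀ k, 0 < Λ k := fun k => lt_of_lt_of_le (by positivity) (hΛ k)
  have hΛi : ∀ k, 0 ≤ (Λ k)⁻¹ := fun k => inv_nonneg.2 (hΛ0 k).le
  have hW : ∀ k, 0 ≤ W k := fun k => by positivity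
  have hf1 := summable_mul_and_tsum_le hf hΛi hf2 hΛs
  have hg1 := summable_mul_and_tsum_le hg hΛi hg2 hΛs
  have h1 := summable_trilinear hW hg (fun k => mul_nonneg (hf k) (hΛi k)) hv hg2 hf1.1
  -- The second half of the estimate exchanges the roles of `f` and `g`, which reflects `W`.
  have hvn : Summable fun k : ℤ => W (-k) ^ 2 := ((Equiv.neg ℤ).summable_iff (f := fun k => W k ^ 2)).2 hv
  have hvne : ∑' k : ℤ, W (-k) ^ 2 = ∑' k, W k ^ 2 := (Equiv.neg ℤ).tsum_eq fun k => W k ^ 2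
  have h2 := summable_trilinear (fun k => hW (-k)) hf (fun k => mul_nonneg (hg k) (hΛi k)) hvn hf2
    hg1.1
  have h2s : Summable fun p : ℤ × ℤ => W (-(p.1 - p.2)) * f p.1 * (g p.2 * (Λ p.2)⁻¹) :=
    (Equiv.prodComm ℤ ℤ).summable_iff.2 h2.1
  have h2t := (Equiv.prodComm ℤ ℤ).tsum_eq
    fun p : ℤ × ℤ => W (-(p.2 - p.1)) * f p.2 * (g p.1 * (Λ p.1)⁻¹)
  have hle : ∀ p : ℤ × ℤ, ‖v (p.2 - p.1)‖ * (f p.1 / Λ p.1) * (g p.2 / Λ p.2)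
      ≤ W (p.2 - p.1) * g p.2 * (f p.1 * (Λ p.1)⁻¹)
        + W (-(p.1 - p.2)) * f p.1 * (g p.2 * (Λ p.2)⁻¹) := fun ⟨l, j⟩ => by
    have e1 : ‖v (j - l)‖ = W (j - l) * (1 + |((j - l : ℤ) : ℝ)|) := by
      rw [hWdef]; field_simp
    -- The derivative lost by `v` falls on one of the two factors and cancels its weight. The other
    -- factor keeps `Λ⁻¹`, becomes `ℓ¹` by Cauchy-Schwarz, and produces the constant `√(∑ Λ⁻²)`,
    -- which is later made small.
    have e2 : 1 + |((j - l : ℤ) : ℝ)| ≤ Λ j + Λ l := by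
      have := hΛ j
      have := hΛ l
      have := abs_sub (j : ℝ) l
      push_cast
      linarith
    have p1 := hΛ0 j
    have p2 := hΛ0 l
    have p3 := hf l
    have p4 := hg j
    have p5 := hW (j - l)
    simp only [neg_sub]
    calc ‖v (j - l)‖ * (f l / Λ l) * (g j / Λ j)
        ≤ W (j - l) * (Λ j + Λ l) * (f l / Λ l) * (g j / Λ j) := by rw [e1]; gcongr
      _ = _ := by field_simp
  have h3 := h1.1.add h2s
  have h4 := Summable.of_nonneg_of_le (fun p : ℤ × ℤ => mul_nonneg (mul_nonneg (norm_nonneg _)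
    (div_nonneg (hf p.1) (hΛ0 _).le)) (div_nonneg (hg p.2) (hΛ0 _).le)) hle h3
  refine ⟨h4, (h4.tsum_le_tsum hle h3).trans ?_⟩
  rw [h1.1.tsum_add h2s]
  have h5 := h2t.trans_le h2.2
  simp only [Equiv.prodComm_apply, Prod.fst_swap, Prod.snd_swap, hvne] at h5
  have n1 := Real.sqrt_nonneg (∑' k, W k ^ 2)
  have n2 := Real.sqrt_nonneg (∑' k, f k ^ 2)
  have n3 := Real.sqrt_nonneg (∑' k, g k ^ 2)
  have h6 := h1.2.trans (mul_le_mul_of_nonneg_left hf1.2 (mul_nonneg n1 n3))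
  have h7 := h5.trans (mul_le_mul_of_nonneg_left hg1.2 (mul_nonneg n1 n2))
  linarith

theorem summable_inv_one_add_abs_sq : Summable fun k : ℤ => (1 + |(k : ℝ)|)⁻¹ ^ 2 := by
  refine Summable.of_norm_bounded_eventually (g := fun k : ℤ => |(k : ℝ)| ^ (-2 : ℝ))
    (Real.summable_abs_int_rpow (by norm_num)) ?_
  filter_upwards [(Set.finite_singleton (0 : ℤ)).compl_mem_cofinite] with k hk
  have hk' : 0 < |(k : ℝ)| := abs_pos.2 (by exact_mod_cast hk)
  rw [Real.rpow_neg hk'.le, Real.norm_of_nonneg (by positivity), Real.rpow_two, ← inv_pow]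
  gcongr
  linarith

/-! ### Sobolev spaces -/

theorem norm_two_pi_mul (k : ℤ) : ‖(2 * Real.pi * k : ℂ)‖ = 2 * Real.pi * |(k : ℝ)| := by
  rw [show (2 * Real.pi * k : ℂ) = ((2 * Real.pi * k : ℝ) : ℂ) by push_cast; rfl,
    Complex.norm_real, Real.norm_eq_abs, abs_mul, abs_of_pos Real.two_pi_pos]

theorem mem_sobolev_one_iff (u : L2) :
    u ∈ sobolev 1 ↔ Summable fun k : ℤ => ‖(2 * Real.pi * k : ℂ) * fourierCoeff u k‖ ^ 2 := by
  have e : ∀ k : ℤ, (1 + (2 * Real.pi * (k : ℝ)) ^ 2) ^ (1 : ℝ) * ‖fourierCoeff u k‖ ^ 2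
      = ‖fourierCoeff u k‖ ^ 2 + ‖(2 * Real.pi * k : ℂ) * fourierCoeff u k‖ ^ 2 := fun k => by
    rw [Real.rpow_one, norm_mul (2 * Real.pi * k : ℂ), norm_two_pi_mul, mul_pow _ ‖_‖,
      mul_pow _ |_|, sq_abs]
    ring
  have hu := (hasSum_norm_sq u).summable
  rw [sobolev, Set.mem_ofPred_eq, summable_congr e]
  exact ⟨fun h => by simpa using h.sub hu, hu.add⟩

theorem mem_sobolev_two_iff (u : L2) :
    u ∈ sobolev 2 ↔ Summable fun k : ℤ => ‖(2 * Real.pi * k : ℂ) ^ 2 * fourierCoeff u k‖ ^ 2 := by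
  have e : ∀ k : ℤ, ‖(2 * Real.pi * k : ℂ) ^ 2 * fourierCoeff u k‖ ^ 2
      = ((2 * Real.pi * (k : ℝ)) ^ 2) ^ 2 * ‖fourierCoeff u k‖ ^ 2 := fun k => by
    rw [norm_mul, norm_pow, norm_two_pi_mul, mul_pow _ ‖_‖, mul_pow _ |_|, sq_abs]
    ring
  have hu := (hasSum_norm_sq u).summable
  rw [sobolev, Set.mem_ofPred_eq, summable_congr e]
  simp only [Real.rpow_two]
  constructor
  · refine fun h => Summable.of_nonneg_of_le (fun k => by positivity) (fun k => ?_) h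
    gcongr
    linarith
  · refine fun h => Summable.of_nonneg_of_le (fun k => by positivity) (fun k => ?_)
      ((hu.add h).mul_left 2)
    rw [show ‖fourierCoeff u k‖ ^ 2 + ((2 * Real.pi * (k : ℝ)) ^ 2) ^ 2 * ‖fourierCoeff u k‖ ^ 2
      = (1 + ((2 * Real.pi * (k : ℝ)) ^ 2) ^ 2) * ‖fourierCoeff u k‖ ^ 2 by ring, ← mul_assoc]
    gcongr
    nlinarith [sq_nonneg (1 - (2 * Real.pi * (k : ℝ)) ^ 2)]

theorem sobolev_two_subset : sobolev 2 ⊆ sobolev 1 := fun u hu => by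
  rw [mem_sobolev_two_iff] at hu
  rw [mem_sobolev_one_iff]
  refine Summable.of_nonneg_of_le (fun k => by positivity) (fun k => ?_) hu
  rcases eq_or_ne k 0 with rfl | hk
  · simp
  · have h1 : 1 ≤ ‖(2 * Real.pi * k : ℂ)‖ := by
      have h2 : (1 : ℝ) ≤ |(k : ℝ)| := by exact_mod_cast Int.one_le_abs hk
      rw [norm_two_pi_mul]
      nlinarith [Real.pi_gt_three]
    rw [norm_mul (2 * Real.pi * k : ℂ), norm_mul (_ ^ 2), norm_pow]
    gcongr
    exact le_self_pow₀ h1 two_ne_zero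

theorem add_mem_sobolev_one {u v : L2} (hu : u ∈ sobolev 1) (hv : v ∈ sobolev 1) :
    u + v ∈ sobolev 1 := by
  rw [mem_sobolev_one_iff] at *
  refine Summable.of_nonneg_of_le (fun k => by positivity) (fun k => ?_) ((hu.add hv).mul_left 2)
  rw [fourierCoeff_add, mul_add]
  have := norm_add_le ((2 * Real.pi * k : ℂ) * fourierCoeff u k)
    ((2 * Real.pi * k : ℂ) * fourierCoeff v k)
  have h2 := pow_le_pow_left₀ (norm_nonneg _) this 2
  exact h2.trans (add_sq_le (R := ℝ))

theorem smul_mem_sobolev_one (c : ℂ) {u : L2} (hu : u ∈ sobolev 1) : c • u ∈ sobolev 1 := by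
  rw [mem_sobolev_one_iff] at *
  refine (hu.mul_left (‖c‖ ^ 2)).congr fun k => ?_
  rw [fourierCoeff_smul, mul_left_comm, norm_mul c, mul_pow]

theorem summable_one_add_abs_mul {u : L2} (hu : u ∈ sobolev 1) :
    Summable fun k : ℤ => ((1 + |(k : ℝ)|) * ‖fourierCoeff u k‖) ^ 2 := by
  rw [mem_sobolev_one_iff] at hu
  refine Summable.of_nonneg_of_le (fun k => by positivity) (fun k => ?_)
    (((hasSum_norm_sq u).summable.add hu).mul_left 2)
  rw [norm_mul (2 * Real.pi * k : ℂ), norm_two_pi_mul]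
  set t := |(k : ℝ)|
  have ht : 0 ≤ t := abs_nonneg _
  rw [mul_pow, mul_pow, ← one_add_mul, ← mul_assoc]
  gcongr
  have h1 : t ≤ 2 * Real.pi * t := by nlinarith [Real.pi_gt_three]
  nlinarith [sq_nonneg (1 - t)]

theorem fourierLp_mem_sobolev_one (k : ℤ) : (fourierLp 2 k : L2) ∈ sobolev 1 := by
  rw [mem_sobolev_one_iff]
  refine summable_of_ne_finset_zero (s := {k}) fun j hj => ?_
  rw [← inner_fourierLp, orthonormal_iff_ite.1 orthonormal_fourier, if_neg (by simpa using hj)]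
  simp

theorem fourierCoeff_dx {u : L2} (hu : u ∈ sobolev 1) (k : ℤ) :
    fourierCoeff (dx u) k = 2 * Real.pi * Complex.I * k * fourierCoeff u k := by
  refine fourierCoeff_ofCoeff (c := fun k : ℤ => 2 * Real.pi * Complex.I * k * fourierCoeff u k)
    ?_ k
  refine ((mem_sobolev_one_iff u).1 hu).congr fun k => ?_
  simp only [norm_mul, Complex.norm_I, mul_one]

/-! ### The form in Fourier coefficients -/

theorem exists_fourier_mul (u : L2) (k : ℤ) :
    ∃ w : L2, w =ᵐ[AddCircle.haarAddCircle] fun x => fourier k x * u x := by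
  have h : MemLp (fun x : UnitAddCircle => fourier k x * u x) 2 AddCircle.haarAddCircle := by
    refine (Lp.memLp u).of_le ((fourier k).continuous.aestronglyMeasurable.mul
      (Lp.memLp u).aestronglyMeasurable) (Filter.Eventually.of_forall fun x => ?_)
    rw [norm_mul, fourier_apply, Circle.norm_coe, one_mul]
  exact ⟨h.toLp _, h.coeFn_toLp⟩

/-- The left side is Parseval's series for `⟨e_k u, φ⟩`: multiplication by `e_k` preserves `L²` and
shifts coefficients. This avoids treating `u φ̄` as more than an integrable function. -/
theorem hasSum_fourierCoeff_mul_conj (u φ : L2) (k : ℤ) :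
    HasSum (fun j => conj (fourierCoeff φ j) * fourierCoeff u (j - k))
      (fourierCoeff (fun x : UnitAddCircle => u x * conj (φ x)) (-k)) := by
  obtain ⟨w, hw⟩ := exists_fourier_mul u k
  have h := hasSum_inner φ w
  have h1 : ∀ j, fourierCoeff w j = fourierCoeff u (j - k) := fun j => by
    rw [fourierCoeff_congr_ae hw, fourierCoeff_fourier_mul]
  simp only [h1] at h
  convert h using 1
  rw [L2.inner_def, fourierCoeff]
  refine integral_congr_ae ?_
  filter_upwards [hw] with x hx
  rw [hx, neg_neg, RCLike.inner_apply, smul_eq_mul]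
  ring

/-- The Fourier coefficients of `V u`. -/
def potentialCoeff (V : CircleDistribution) (u : L2) (j : ℤ) : ℂ :=
  ∑' l : ℤ, V.coeff (j - l) * fourierCoeff u l

/-- The terms of `⟨V u, φ⟩` as a double series. -/
def pairTerm (V : CircleDistribution) (u φ : L2) (p : ℤ × ℤ) : ℂ :=
  V.coeff (p.2 - p.1) * fourierCoeff u p.1 * conj (fourierCoeff φ p.2)

/-- `V` belongs to `H^{-1}`. -/
def MemNegSobolev (V : CircleDistribution) : Prop :=
  Summable fun k : ℤ => (‖V.coeff k‖ / (1 + |(k : ℝ)|)) ^ 2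

variable {V : CircleDistribution}

theorem summable_pairTerm (hV : MemNegSobolev V) {u φ : L2} (hu : u ∈ sobolev 1)
    (hφ : φ ∈ sobolev 1) : Summable (pairTerm V u φ) := by
  have h := (summable_potential_form hV (Λ := fun k : ℤ => 1 + |(k : ℝ)|) (fun k => le_rfl)
    summable_inv_one_add_abs_sq (fun k => by positivity) (fun k => by positivity)
    (summable_one_add_abs_mul hu) (summable_one_add_abs_mul hφ)).1
  refine Summable.of_norm (h.congr fun p => ?_)
  rw [pairTerm, norm_mul, norm_mul, RCLike.norm_conj]
  field_simp

theorem summable_potentialCoeff (hV : MemNegSobolev V) {u : L2} (hu : u ∈ sobolev 1) (j : ℤ) :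
    Summable fun l : ℤ => V.coeff (j - l) * fourierCoeff u l := by
  have h := (summable_pairTerm hV hu (fourierLp_mem_sobolev_one j)).prod_symm.prod_factor j
  refine h.congr fun l => ?_
  simp only [pairTerm, Prod.swap_prod_mk]
  rw [← inner_fourierLp (fourierLp 2 j), orthonormal_iff_ite.1 orthonormal_fourier]
  simp

theorem hasSum_potentialTerm (hV : MemNegSobolev V) {u φ : L2} (hu : u ∈ sobolev 1)
    (hφ : φ ∈ sobolev 1) : HasSum (potentialTerm V u φ) (∑' p, pairTerm V u φ p) := by
  -- The involution passes from the pair (frequency of `V`, frequency of `φ`) to the pair (frequency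
  -- of `u`, frequency of `φ`).
  let e : ℤ × ℤ ≃ ℤ × ℤ :=
    { toFun := fun p => (p.2 - p.1, p.2)
      invFun := fun p => (p.2 - p.1, p.2)
      left_inv := fun p => by simp
      right_inv := fun p => by simp }
  have h := e.hasSum_iff.2 (summable_pairTerm hV hu hφ).hasSum
  refine h.prod_fiberwise fun k => ?_
  refine ((hasSum_fourierCoeff_mul_conj u φ k).mul_left (V.coeff k)).congr_fun fun j => ?_
  simp only [e, Function.comp_apply, pairTerm, Equiv.coe_fn_mk, sub_sub_cancel]
  ring

theorem form_eq (hV : MemNegSobolev V) {u φ : L2} (hu : u ∈ sobolev 1) (hφ : φ ∈ sobolev 1) :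
    form V u φ = inner ℂ (dx φ) (dx u) + ∑' p, pairTerm V u φ p := by
  rw [form, (hasSum_potentialTerm hV hu hφ).tsum_eq]

theorem hasSum_inner_dx {u φ : L2} (hu : u ∈ sobolev 1) (hφ : φ ∈ sobolev 1) :
    HasSum (fun j : ℤ => conj (fourierCoeff φ j) * ((2 * Real.pi * j : ℂ) ^ 2 * fourierCoeff u j))
      (inner ℂ (dx φ) (dx u)) := by
  refine (hasSum_inner (dx φ) (dx u)).congr_fun fun j => ?_
  rw [fourierCoeff_dx hu, fourierCoeff_dx hφ]
  simp only [map_mul, Complex.conj_I, Complex.conj_ofReal, map_ofNat, map_intCast]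
  linear_combination ((2 * Real.pi * j : ℂ) ^ 2 * conj (fourierCoeff φ j) * fourierCoeff u j)
    * Complex.I_sq

theorem hasSum_form (hV : MemNegSobolev V) {u φ : L2} (hu : u ∈ sobolev 1) (hφ : φ ∈ sobolev 1) :
    HasSum (fun j : ℤ => conj (fourierCoeff φ j) *
      ((2 * Real.pi * j : ℂ) ^ 2 * fourierCoeff u j + potentialCoeff V u j)) (form V u φ) := by
  rw [form_eq hV hu hφ]
  have h := (Equiv.prodComm ℤ ℤ).hasSum_iff.2 (summable_pairTerm hV hu hφ).hasSum
  have h2 := h.prod_fiberwise (g := fun j => conj (fourierCoeff φ j) * potentialCoeff V u j)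
    fun j => by
      refine ((summable_potentialCoeff hV hu j).hasSum.mul_left
        (conj (fourierCoeff φ j))).congr_fun fun l => ?_
      simp only [Function.comp_apply, Equiv.prodComm_apply, Prod.swap_prod_mk, pairTerm]
      ring
  refine ((hasSum_inner_dx hu hφ).add h2).congr_fun fun j => ?_
  ring

/-- `H u = v` in terms of Fourier coefficients. -/
theorem isImage_iff (hV : MemNegSobolev V) (u v : L2) :
    IsImage V u v ↔ u ∈ sobolev 1 ∧ ∀ j : ℤ,
      (2 * Real.pi * j : ℂ) ^ 2 * fourierCoeff u j + potentialCoeff V u j = fourierCoeff v j := by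
  refine and_congr_right fun hu => ⟨fun h j => ?_, fun h φ hφ => ?_⟩
  · have h1 := h _ (fourierLp_mem_sobolev_one j)
    rw [inner_fourierLp] at h1
    rw [← h1]
    refine HasSum.unique ?_ (hasSum_form hV hu (fourierLp_mem_sobolev_one j))
    have h2 : ∀ i, fourierCoeff (fourierLp 2 j : L2) i = if i = j then 1 else 0 := fun i => by
      rw [← inner_fourierLp, orthonormal_iff_ite.1 orthonormal_fourier]
    convert hasSum_ite_eq j ((2 * Real.pi * j : ℂ) ^ 2 * fourierCoeff u j + potentialCoeff V u j)
      using 2 with i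
    rw [h2]
    split_ifs with hij
    · rw [hij, map_one, one_mul]
    · rw [map_zero, zero_mul]
  · refine (hasSum_form hV hu hφ).unique ?_
    simp only [h]
    exact hasSum_inner φ v

theorem mem_formOperatorDomain_iff (hV : MemNegSobolev V) (u : L2) :
    u ∈ formOperatorDomain V ↔ u ∈ sobolev 1 ∧ Summable fun j : ℤ =>
      ‖(2 * Real.pi * j : ℂ) ^ 2 * fourierCoeff u j + potentialCoeff V u j‖ ^ 2 := by
  constructor
  · rintro ⟨v, hv⟩
    rw [isImage_iff hV] at hv
    refine ⟨hv.1, ?_⟩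
    simp only [hv.2]
    exact (hasSum_norm_sq v).summable
  · rintro ⟨hu, hs⟩
    exact ⟨ofCoeff _, (isImage_iff hV _ _).2 ⟨hu, fun j => (fourierCoeff_ofCoeff hs j).symm⟩⟩

variable {D : DyadicPartition}

/-! ### Convergence of the paraproduct -/

theorem hasSum_fourierCoeff_trig_mul {a b : ℤ → ℂ} {s t : Finset ℤ} (hs : ∀ k ∉ s, a k = 0)
    (ht : ∀ k ∉ t, b k = 0) (j : ℤ) :
    HasSum (fun l => a l * b (j - l)) (fourierCoeff (toL2 (trig a * trig b)) j) := by
  rw [fourierCoeff_toL2_trig_mul hs ht]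
  exact hasSum_sum_of_ne_finset_zero fun l hl => by rw [hs l hl, zero_mul]

theorem DyadicPartition.exists_finset_mul (D : DyadicPartition) (n : ℕ) (c : ℤ → ℂ) :
    ∃ s : Finset ℤ, ∀ k ∉ s, (D.cutoff n (k : ℝ) : ℂ) * c k = 0 := by
  obtain ⟨s, hs⟩ := D.exists_finset n
  exact ⟨s, fun k hk => by rw [hs k hk, Complex.ofReal_zero, zero_mul]⟩

theorem norm_toL2_trig_cutoff_le {n : ℕ} {c : ℤ → ℂ} {u : L2} {K : ℝ} (hK : 0 ≤ K)
    (h : ∀ k : ℤ, D.cutoff n k ≠ 0 → |D.cutoff n k| * ‖c k‖ ≤ K * ‖fourierCoeff u k‖) :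
    ‖toL2 (trig fun k => (D.cutoff n (k : ℝ) : ℂ) * c k)‖ ≤ K * ‖u‖ := by
  obtain ⟨s, hs⟩ := D.exists_finset_mul n c
  refine norm_le_of_fourierCoeff_le hK fun k => ?_
  rw [fourierCoeff_toL2_trig hs, norm_mul, Complex.norm_real, Real.norm_eq_abs]
  by_cases hk : D.cutoff n k = 0
  · rw [hk, abs_zero, zero_mul]; positivity
  · exact h k hk

theorem block_invLaplaceCoeff (D : DyadicPartition) (V : CircleDistribution) (m : ℕ) :
    block D m (invLaplaceCoeff V) = (-(1 / (2 * Real.pi) ^ 2) : ℂ) •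
      trig fun k => (D.cutoff m (k : ℝ) : ℂ) * (V.coeff k / (k : ℂ) ^ 2) := by
  obtain ⟨s, hs⟩ := D.exists_finset_mul m fun k => V.coeff k / (k : ℂ) ^ 2
  rw [← trig_const_mul _ hs, block, trig]
  congr 1
  ext1 k
  congr 1
  rw [invLaplaceCoeff]
  split_ifs with hk
  -- At `k = 0` the convention `x / 0 = 0` agrees with `X̂(0) = 0`.
  · simp [hk]
  · rw [mul_pow]
    ring

/-- Inverting the Laplacian gains `2 ^ (-2m)` against the `2 ^ m q ^ m` of `V`, so one power `2 ^ m`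
remains to spare. Only blocks with `m ≥ 1` lie in annuli; the paraproduct uses no other. -/
theorem exists_norm_block_invLaplace_le {C q : ℝ} (hC : 0 ≤ C)
    (h : ∀ m, ‖block D m V.coeff‖ ≤ C * (2 ^ m * q ^ m)) :
    ∃ K : ℝ, 0 ≤ K ∧ ∀ m, 1 ≤ m → 2 ^ m * ‖block D m (invLaplaceCoeff V)‖ ≤ K * q ^ m := by
  obtain ⟨C₂, hC₂, h₂⟩ := exists_norm_trig_cutoff_div_le D 2
  refine ⟨‖(-(1 / (2 * Real.pi) ^ 2) : ℂ)‖ * (C₂ * 4 * C), by positivity, fun m hm => ?_⟩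
  obtain ⟨m, rfl⟩ : ∃ m', m = m' + 1 := ⟨m - 1, by omega⟩
  rw [block_invLaplaceCoeff, norm_smul]
  calc _ ≤ 2 ^ (m + 1) * (‖(-(1 / (2 * Real.pi) ^ 2) : ℂ)‖ *
        (C₂ * ((2 ^ m) ^ 2)⁻¹ * (C * (2 ^ (m + 1) * q ^ (m + 1))))) := by
        gcongr
        refine (h₂ m V.coeff).trans ?_
        gcongr
        exact h _
    _ = _ := by
        rw [pow_succ 2 m]
        field_simp
        ring

/-- The spare factor `2 ^ p.2` pays for one derivative of the product. As `p.1 < p.2`, `q ^ p.2 = s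
^ (2 * p.2)` is dominated by a product of geometric terms, summable over pairs. -/
theorem norm_paraTerm_le {A : ℝ} (hA : ∀ n z, |D.cutoff n z| ≤ A) {K q s : ℝ} (hs0 : 0 < s)
    (hs1 : s < 1) (hq : q = s ^ 2) (hK0 : 0 ≤ K)
    (hK : ∀ m, 1 ≤ m → 2 ^ m * ‖block D m (invLaplaceCoeff V)‖ ≤ K * q ^ m) (u : L2)
    (p : ℕ × ℕ) :
    2 ^ p.2 * ‖paraTerm D u (invLaplaceCoeff V) p‖ ≤ A * ‖u‖ * K * (s ^ p.1 * s ^ p.2) := by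
  have hA0 : 0 ≤ A := (abs_nonneg _).trans (hA 0 0)
  rw [paraTerm]
  split_ifs with hp
  · have h1 : ‖toL2 (block D p.1 (fourierCoeff u))‖ ≤ A * ‖u‖ :=
      norm_toL2_trig_cutoff_le hA0 fun k _ => by gcongr; exact hA _ _
    have h2 : q ^ p.2 ≤ s ^ p.1 * s ^ p.2 := by
      rw [hq, ← pow_mul, mul_comm 2, mul_two, pow_add]
      have : s ^ p.2 ≤ s ^ p.1 := pow_le_pow_of_le_one hs0.le hs1.le (by omega)
      gcongr
    rw [mul_comm (block D p.1 _)]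
    calc _ ≤ 2 ^ p.2 * (‖block D p.2 (invLaplaceCoeff V)‖
          * ‖toL2 (block D p.1 (fourierCoeff u))‖) := by
            gcongr; exact norm_toL2_mul_le _ _
      _ = ‖toL2 (block D p.1 (fourierCoeff u))‖
          * (2 ^ p.2 * ‖block D p.2 (invLaplaceCoeff V)‖) := by ring
      _ ≤ (A * ‖u‖) * (K * q ^ p.2) :=
        mul_le_mul h1 (hK p.2 (by omega)) (by positivity) (by positivity)
      _ ≤ (A * ‖u‖) * (K * (s ^ p.1 * s ^ p.2)) := by gcongr
      _ = _ := by ring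
  · rw [norm_zero, mul_zero]; positivity

theorem summable_geometric_prod {s : ℝ} (hs0 : 0 < s) (hs1 : s < 1) :
    Summable fun p : ℕ × ℕ => s ^ p.1 * s ^ p.2 :=
  (summable_geometric_of_lt_one hs0.le hs1).mul_of_nonneg
    (summable_geometric_of_lt_one hs0.le hs1) (fun _ => by positivity) (fun _ => by positivity)

/-- The regularity of `V` in the form in which it is used: geometric bounds on its blocks. -/
structure BlockBound (D : DyadicPartition) (V : CircleDistribution) (s C : ℝ) : Prop where
  pos : 0 < s
  lt_one : s < 1
  one_le : 1 ≤ 2 * s ^ 2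
  nonneg : 0 ≤ C
  block_le : ∀ m, ‖block D m V.coeff‖ ≤ C * (2 ^ m * (s ^ 2) ^ m)

theorem MemHolderBesov.exists_blockBound {κ : ℝ} (hκ₀ : 0 < κ) (hκ₁ : κ < 1)
    (h : MemHolderBesov D (-1 + κ) V.coeff) : ∃ s C, BlockBound D V s C := by
  obtain ⟨C, hC, hb⟩ := h.exists_block_le
  have e : ((2 : ℝ) ^ (-κ / 2)) ^ 2 = 2 ^ (-κ) := by
    rw [← Real.rpow_natCast, ← Real.rpow_mul (by norm_num)]
    congr 1
    push_cast
    ring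
  -- Taking `s` as the square root of `2 ^ (-κ)` allows the decay to be shared between both indices;
  -- `κ < 1` gives `2 s² ≥ 1`.
  refine ⟨2 ^ (-κ / 2), C, by positivity,
    Real.rpow_lt_one_of_one_lt_of_neg (by norm_num) (by linarith), ?_, hC, by rwa [e]⟩
  rw [e]
  calc (1 : ℝ) = 2 * 2 ^ (-1 : ℝ) := by rw [Real.rpow_neg_one]; norm_num
    _ ≤ 2 * 2 ^ (-κ) := by gcongr; linarith

variable {s C : ℝ}

theorem BlockBound.memNegSobolev (h : BlockBound D V s C) : MemNegSobolev V :=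
  summable_div_one_add_abs (sq_nonneg s) (pow_lt_one₀ h.pos.le h.lt_one two_ne_zero) h.block_le

theorem BlockBound.summable_paraTerm (h : BlockBound D V s C) (u : L2) :
    Summable (paraTerm D u (invLaplaceCoeff V)) := by
  obtain ⟨A, hA1, hA, -⟩ := D.exists_cutoff_bounds
  obtain ⟨K, hK0, hK⟩ := exists_norm_block_invLaplace_le h.nonneg h.block_le
  refine Summable.of_norm_bounded
    ((summable_geometric_prod h.pos h.lt_one).mul_left (A * ‖u‖ * K)) fun p => ?_
  refine le_trans ?_ (norm_paraTerm_le hA h.pos h.lt_one rfl hK0 hK u p)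
  exact le_mul_of_one_le_left (norm_nonneg _) (one_le_pow₀ (by norm_num))

theorem hasSum_fourierCoeff_paraTerm (D : DyadicPartition) (V : CircleDistribution) (u : L2)
    {p : ℕ × ℕ} (hp : p.1 + 1 < p.2) (j : ℤ) :
    HasSum (fun l : ℤ => (D.cutoff p.1 l : ℂ) * fourierCoeff u l *
        ((D.cutoff p.2 ((j - l : ℤ) : ℝ) : ℂ) * invLaplaceCoeff V (j - l)))
      (fourierCoeff (paraTerm D u (invLaplaceCoeff V) p) j) := by
  obtain ⟨s, hs⟩ := D.exists_finset_mul p.1 (fourierCoeff u)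
  obtain ⟨t, ht⟩ := D.exists_finset_mul p.2 (invLaplaceCoeff V)
  rw [paraTerm, if_pos hp]
  exact hasSum_fourierCoeff_trig_mul hs ht j

/-- The paraproduct with `X` maps `L²` to `H¹`. -/
theorem BlockBound.paraproduct_mem (h : BlockBound D V s C) (u : L2) :
    paraproduct D u (invLaplaceCoeff V) ∈ sobolev 1 := by
  obtain ⟨A, hA1, hA, hA2, -⟩ := D.exists_cutoff_bounds
  obtain ⟨K, hK0, hK⟩ := exists_norm_block_invLaplace_le h.nonneg h.block_le
  rw [mem_sobolev_one_iff]
  refine summable_mul_fourierCoeff_tsum (w := fun k : ℤ => (2 * Real.pi * k : ℂ))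
    (h.summable_paraTerm u) ((summable_geometric_prod h.pos h.lt_one).mul_left
    (2 * Real.pi * (2 * A) * (A * ‖u‖ * K))) fun p => ?_
  obtain ⟨y, hy1, hy2⟩ := exists_fourierCoeff_mul (paraTerm D u (invLaplaceCoeff V) p)
    (w := fun k : ℤ => (2 * Real.pi * k : ℂ)) (C := 2 * Real.pi * (2 * A * 2 ^ p.2))
    (by positivity) fun j hj => by
      rw [norm_two_pi_mul]
      gcongr
      by_cases hp : p.1 + 1 < p.2
      -- Frequencies add under multiplication: each factor has frequency at most `A 2 ^ p.2`, so no
      -- coefficient survives beyond `2 A 2 ^ p.2`.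
      · by_contra! hlt
        refine hj ((hasSum_fourierCoeff_paraTerm D V u hp j).unique ?_)
        convert hasSum_zero using 2 with l
        by_cases h1 : D.cutoff p.1 l = 0
        · simp [h1]
        by_cases h2 : D.cutoff p.2 ((j - l : ℤ) : ℝ) = 0
        · rw [h2]; simp
        exfalso
        have e1 := hA2 _ _ h1
        have e2 := hA2 _ _ h2
        have e3 : (2 : ℝ) ^ p.1 ≤ 2 ^ p.2 := pow_le_pow_right₀ (by norm_num) (by omega)
        have e4 : |(j : ℝ)| ≤ |(l : ℝ)| + |((j - l : ℤ) : ℝ)| := by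
          push_cast
          calc |(j : ℝ)| = |(l : ℝ) + (j - l)| := by ring_nf
            _ ≤ _ := abs_add_le _ _
        nlinarith
      · exfalso
        rw [paraTerm, if_neg hp] at hj
        exact hj (fourierCoeff_zero j)
  refine ⟨y, hy1, hy2.trans ?_⟩
  have := norm_paraTerm_le hA h.pos h.lt_one rfl hK0 hK u p
  calc _ = 2 * Real.pi * (2 * A) * (2 ^ p.2 * ‖paraTerm D u (invLaplaceCoeff V) p‖) := by ring
    _ ≤ 2 * Real.pi * (2 * A) * (A * ‖u‖ * K * (s ^ p.1 * s ^ p.2)) := by gcongr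
    _ = _ := by ring

/-! ### The paraproduct expansion of `V u` -/

/-- The Littlewood-Paley decomposition of the product `V u`. -/
theorem hasSum_potentialCoeff (D : DyadicPartition) (hV : MemNegSobolev V) {u : L2}
    (hu : u ∈ sobolev 1) (j : ℤ) {c : ℕ × ℕ → ℂ}
    (hc : ∀ p : ℕ × ℕ, HasSum (fun l : ℤ => (D.cutoff p.1 l : ℂ) *
      (D.cutoff p.2 ((j - l : ℤ) : ℝ) : ℂ) * (V.coeff (j - l) * fourierCoeff u l)) (c p)) :
    HasSum c (potentialCoeff V u j) := by
  obtain ⟨A, -, hA, -⟩ := D.exists_cutoff_bounds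
  have hA0 : 0 ≤ A := (abs_nonneg _).trans (hA 0 0)
  set F : ℤ × (ℕ × ℕ) → ℂ := fun x => (D.cutoff x.2.1 x.1 : ℂ) *
    (D.cutoff x.2.2 ((j - x.1 : ℤ) : ℝ) : ℂ) * (V.coeff (j - x.1) * fourierCoeff u x.1) with hF
  have hs := summable_potentialCoeff hV hu j
  have hz := fun z : ℝ => D.summable_abs_cutoff hA z
  have hmul : ∀ x y : ℝ, Summable fun p : ℕ × ℕ => |D.cutoff p.1 x| * |D.cutoff p.2 y| :=
    fun x y => (hz x).1.mul_of_nonneg (hz y).1 (fun _ => abs_nonneg _) fun _ => abs_nonneg _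
  have hFn : ∀ l (p : ℕ × ℕ), ‖F (l, p)‖ = |D.cutoff p.1 l| * |D.cutoff p.2 ((j - l : ℤ) : ℝ)| *
      ‖V.coeff (j - l) * fourierCoeff u l‖ := fun l p => by
    rw [hF]
    simp only [norm_mul, Complex.norm_real, Real.norm_eq_abs]
  -- Inserting the two partitions of unity costs at most `(2A)²` at each frequency `l`, so absolute
  -- convergence persists and the sums over blocks and over `l` can be exchanged.
  have hFs : Summable F := by
    refine Summable.of_norm ((summable_prod_of_nonneg fun _ => norm_nonneg _).2 ⟨fun l => ?_, ?_⟩)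
    · simp only [hFn]
      exact (hmul _ _).mul_right _
    · refine Summable.of_nonneg_of_le (fun l => tsum_nonneg fun p => norm_nonneg _) (fun l => ?_)
        (hs.norm.mul_left (2 * A * (2 * A)))
      simp only [hFn]
      rw [tsum_mul_right, ← (hz l).1.tsum_mul_tsum (hz _).1 (hmul _ _)]
      gcongr
      · exact (hz _).2
      · exact (hz _).2
  have h1 : HasSum (fun l => V.coeff (j - l) * fourierCoeff u l) (∑' x, F x) := by
    refine hFs.hasSum.prod_fiberwise fun l => ?_
    have hc1 : ∀ z : ℝ, HasSum (fun n => (D.cutoff n z : ℂ)) 1 := fun z => by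
      simpa using (D.hasSum_cutoff z).mapL Complex.ofRealCLM
    have h2 : Summable fun p : ℕ × ℕ => (D.cutoff p.1 l : ℂ) *
        (D.cutoff p.2 ((j - l : ℤ) : ℝ) : ℂ) := by
      refine Summable.of_norm ((hmul l ((j - l : ℤ) : ℝ)).congr fun p => ?_)
      rw [norm_mul, Complex.norm_real, Complex.norm_real, Real.norm_eq_abs, Real.norm_eq_abs]
    have h3 := (((hc1 l).mul (hc1 ((j - l : ℤ) : ℝ)) h2).mul_right
      (V.coeff (j - l) * fourierCoeff u l))
    rw [one_mul, one_mul] at h3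
    exact h3
  rw [potentialCoeff, h1.tsum_eq]
  exact ((Equiv.prodComm _ _).hasSum_iff.2 hFs.hasSum).prod_fiberwise hc

/-- Up to a function in `L²` with summable bounds, a term of `V u` is `-∂_x²` of the corresponding
term of the paraproduct `P_u X`. -/
theorem BlockBound.exists_remainder (h : BlockBound D V s C) {u : L2} (hu : u ∈ sobolev 1) :
    ∃ K : ℝ, ∀ p : ℕ × ℕ, ∃ z : L2,
      (∀ j : ℤ, HasSum (fun l : ℤ => (D.cutoff p.1 l : ℂ) * (D.cutoff p.2 ((j - l : ℤ) : ℝ) : ℂ) *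
          (V.coeff (j - l) * fourierCoeff u l))
        (fourierCoeff z j - (2 * Real.pi * j : ℂ) ^ 2 *
          fourierCoeff (paraTerm D u (invLaplaceCoeff V) p) j)) ∧
      ‖z‖ ≤ K * (s ^ p.1 * s ^ p.2) := by
  obtain ⟨A, hA1, hA, hA2, hA3⟩ := D.exists_cutoff_bounds
  have hA0 : 0 ≤ A := by linarith
  have hC := h.nonneg
  have hs0 := h.pos
  obtain ⟨C₁, hC₁, h₁⟩ := exists_norm_trig_cutoff_div_le D 1
  obtain ⟨C₂, hC₂, h₂⟩ := exists_norm_trig_cutoff_div_le D 2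
  -- The function `U` has coefficients of modulus `(1 + |l|) |û(l)|`; its `L²` norm plays the part
  -- of the `H^1` norm of `u`.
  obtain ⟨U, hU⟩ : ∃ U : L2, ∀ l : ℤ,
      ‖fourierCoeff U l‖ = (1 + |(l : ℝ)|) * ‖fourierCoeff u l‖ := by
    have hsum : Summable fun l : ℤ => ‖((1 + |(l : ℝ)| : ℝ) : ℂ) * fourierCoeff u l‖ ^ 2 := by
      refine (summable_one_add_abs_mul hu).congr fun l => ?_
      rw [norm_mul, Complex.norm_real, Real.norm_of_nonneg (by positivity)]
    refine ⟨ofCoeff fun l : ℤ => ((1 + |(l : ℝ)| : ℝ) : ℂ) * fourierCoeff u l, fun l => ?_⟩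
    rw [fourierCoeff_ofCoeff hsum, norm_mul, Complex.norm_real, Real.norm_of_nonneg (by positivity)]
  set K₁ := (4 * (C₁ * C * A) + 4 * (C₂ * C * A ^ 2)) * ‖U‖ with hK₁
  set K₂ := 2 * (C * A ^ 2 * ‖U‖) * s⁻¹ with hK₂
  have hK₁0 : 0 ≤ K₁ := by positivity
  have hK₂0 : 0 ≤ K₂ := by positivity
  have hlU : ∀ l : ℤ, |(l : ℝ)| * ‖fourierCoeff u l‖ ≤ ‖fourierCoeff U l‖ := fun l => by
    rw [hU]; gcongr; linarith
  refine ⟨K₁ + K₂, fun ⟨n, m⟩ => ?_⟩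
  have hb : 0 ≤ s ^ n * s ^ m := by positivity
  by_cases hp : n + 1 < m
  · set a : ℕ → ℤ → ℂ := fun i l => (D.cutoff n (l : ℝ) : ℂ) * ((l : ℂ) ^ i * fourierCoeff u l)
      with ha
    set b : ℕ → ℤ → ℂ := fun i k => (D.cutoff m (k : ℝ) : ℂ) * (V.coeff k / (k : ℂ) ^ i) with hbdef
    have hcoef : ∀ i j, HasSum (fun l => a i l * b i (j - l))
        (fourierCoeff (toL2 (trig (a i) * trig (b i))) j) := fun i j => by
      obtain ⟨S, hS⟩ := D.exists_finset_mul n fun l => (l : ℂ) ^ i * fourierCoeff u l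
      obtain ⟨T, hT⟩ := D.exists_finset_mul m fun k => V.coeff k / (k : ℂ) ^ i
      exact hasSum_fourierCoeff_trig_mul hS hT j
    -- These are the two Leibniz corrections: one derivative on each factor, and two derivatives on
    -- `Δ_n u`. With `k = j - l`, the identity is `1 + 2 l / k + l² / k² = j² / k²`.
    refine ⟨(-2 : ℂ) • toL2 (trig (a 1) * trig (b 1)) - toL2 (trig (a 2) * trig (b 2)),
      fun j => ?_, ?_⟩
    · rw [fourierCoeff_sub, fourierCoeff_smul]
      refine ((((hcoef 1 j).mul_left (-2)).sub (hcoef 2 j)).sub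
        ((hasSum_fourierCoeff_paraTerm D V u hp j).mul_left
          ((2 * Real.pi * j : ℂ) ^ 2))).congr_fun fun l => ?_
      by_cases hk : D.cutoff m ((j - l : ℤ) : ℝ) = 0
      · simp only [ha, hbdef, hk, Complex.ofReal_zero, zero_mul, mul_zero, sub_zero]
      have hk0 : j - l ≠ 0 := fun h0 => by
        obtain ⟨m', rfl⟩ : ∃ m', m = m' + 1 := ⟨m - 1, by omega⟩
        have := hA3 _ _ hk
        rw [h0, Int.cast_zero, abs_zero, mul_zero] at this
        have h2 : (0 : ℝ) < 2 ^ (m' + 1) := by positivity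
        linarith
      have hk0' : ((j - l : ℤ) : ℂ) ≠ 0 := by exact_mod_cast hk0
      have hpi : (Real.pi : ℂ) ≠ 0 := by exact_mod_cast Real.pi_ne_zero
      simp only [ha, hbdef, invLaplaceCoeff, if_neg hk0]
      have hj : (j : ℂ) = ((j - l : ℤ) : ℂ) + l := by push_cast; ring
      rw [hj]
      field_simp
      ring
    · have hb1 : ‖trig (b 1)‖ ≤ 2 * (C₁ * C) * (s ^ 2) ^ m := by
        obtain ⟨m', rfl⟩ : ∃ m', m = m' + 1 := ⟨m - 1, by omega⟩
        calc _ ≤ C₁ * ((2 ^ m') ^ 1)⁻¹ * (C * (2 ^ (m' + 1) * (s ^ 2) ^ (m' + 1))) := by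
              refine (h₁ m' V.coeff).trans ?_
              gcongr
              exact h.block_le _
          _ = _ := by
              rw [pow_one, pow_succ 2 m']
              field_simp
      have hb2 : ‖trig (b 2)‖ ≤ 4 * (C₂ * C) * (2 ^ m)⁻¹ * (s ^ 2) ^ m := by
        obtain ⟨m', rfl⟩ : ∃ m', m = m' + 1 := ⟨m - 1, by omega⟩
        calc _ ≤ C₂ * ((2 ^ m') ^ 2)⁻¹ * (C * (2 ^ (m' + 1) * (s ^ 2) ^ (m' + 1))) := by
              refine (h₂ m' V.coeff).trans ?_
              gcongr
              exact h.block_le _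
          _ = _ := by
              rw [pow_succ 2 m']
              field_simp
              ring
      have ha1 : ‖toL2 (trig (a 1))‖ ≤ A * ‖U‖ := norm_toL2_trig_cutoff_le hA0 fun l _ => by
        rw [pow_one, norm_mul, Complex.norm_intCast]
        exact mul_le_mul (hA _ _) (hlU l) (by positivity) hA0
      -- The second derivative costs `2 ^ n` beyond the `H^1` norm; the factor `(2 ^ m)⁻¹` in `hb2`
      -- compensates since `n < m`.
      have ha2 : ‖toL2 (trig (a 2))‖ ≤ A * (A * 2 ^ n) * ‖U‖ :=
        norm_toL2_trig_cutoff_le (by positivity) fun l hl => by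
          rw [norm_mul, norm_pow, Complex.norm_intCast, mul_assoc A]
          refine mul_le_mul (hA _ _) ?_ (by positivity) hA0
          rw [sq, mul_assoc]
          exact mul_le_mul (hA2 _ _ hl) (hlU l) (by positivity) (by positivity)
      have hnm : (2 : ℝ) ^ n ≤ 2 ^ m := pow_le_pow_right₀ (by norm_num) (by omega)
      have hq : (s ^ 2) ^ m ≤ s ^ n * s ^ m := by
        rw [← pow_mul, mul_comm 2, mul_two, pow_add]
        have : s ^ m ≤ s ^ n := pow_le_pow_of_le_one hs0.le h.lt_one.le (by omega)
        gcongr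
      have n1 : ‖toL2 (trig (a 1) * trig (b 1))‖ ≤ 2 * (C₁ * C) * (s ^ 2) ^ m * (A * ‖U‖) := by
        rw [mul_comm (trig (a 1))]
        exact (norm_toL2_mul_le _ _).trans (mul_le_mul hb1 ha1 (norm_nonneg _) (by positivity))
      have n2 : ‖toL2 (trig (a 2) * trig (b 2))‖ ≤ 4 * (C₂ * C) * (s ^ 2) ^ m * (A ^ 2 * ‖U‖) := by
        rw [mul_comm (trig (a 2))]
        refine (norm_toL2_mul_le _ _).trans
          ((mul_le_mul hb2 ha2 (norm_nonneg _) (by positivity)).trans ?_)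
        calc _ = 4 * (C₂ * C) * (s ^ 2) ^ m * (A ^ 2 * ‖U‖) * (2 ^ n * (2 ^ m)⁻¹) := by ring
          _ ≤ 4 * (C₂ * C) * (s ^ 2) ^ m * (A ^ 2 * ‖U‖) * (2 ^ m * (2 ^ m)⁻¹) := by gcongr
          _ = _ := by rw [mul_inv_cancel₀ (by positivity), mul_one]
      calc _ ≤ ‖(-2 : ℂ) • toL2 (trig (a 1) * trig (b 1))‖ + ‖toL2 (trig (a 2) * trig (b 2))‖ :=
            norm_sub_le _ _
        _ ≤ 2 * (2 * (C₁ * C) * (s ^ 2) ^ m * (A * ‖U‖))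
            + 4 * (C₂ * C) * (s ^ 2) ^ m * (A ^ 2 * ‖U‖) := by
            rw [norm_smul, norm_neg, Complex.norm_ofNat]
            gcongr
        _ = K₁ * (s ^ 2) ^ m := by rw [hK₁]; ring
        _ ≤ K₁ * (s ^ n * s ^ m) := by gcongr
        _ ≤ (K₁ + K₂) * (s ^ n * s ^ m) := by gcongr; linarith
  · refine ⟨toL2 (block D n (fourierCoeff u) * block D m V.coeff), fun j => ?_, ?_⟩
    · obtain ⟨S, hS⟩ := D.exists_finset_mul n (fourierCoeff u)
      obtain ⟨T, hT⟩ := D.exists_finset_mul m V.coeff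
      rw [paraTerm, if_neg hp, fourierCoeff_zero, mul_zero, sub_zero]
      refine (hasSum_fourierCoeff_trig_mul hS hT j).congr_fun fun l => ?_
      ring
    · have hn : ‖toL2 (block D n (fourierCoeff u))‖ ≤ A * (A / 2 ^ n) * ‖U‖ :=
        norm_toL2_trig_cutoff_le (by positivity) fun l hl => by
          rw [mul_assoc]
          refine mul_le_mul (hA _ _) ?_ (norm_nonneg _) hA0
          rw [hU, ← mul_assoc]
          refine le_mul_of_one_le_left (norm_nonneg _) ?_
          rw [div_mul_eq_mul_div, le_div_iff₀ (by positivity), one_mul]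
          have := abs_nonneg (l : ℝ)
          cases n with
          | zero => nlinarith
          | succ n => have := hA3 n l hl; nlinarith
      -- Here `m ≤ n + 1`. As `2 s² ≥ 1`, the growth of `Δ_m V` is largest at `m = n + 1`, and the
      -- `2 ^ n` there is cancelled by the decay of `Δ_n u`.
      have hmn : 2 ^ m * (s ^ 2) ^ m ≤ 2 ^ n * (2 * (s⁻¹ * (s ^ n * s ^ m))) := by
        have e1 : (2 * s ^ 2) ^ m ≤ (2 * s ^ 2) ^ (n + 1) := pow_le_pow_right₀ h.one_le (by omega)
        have e2 : s ^ (n + 1) ≤ s ^ m := pow_le_pow_of_le_one hs0.le h.lt_one.le (by omega)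
        calc 2 ^ m * (s ^ 2) ^ m = (2 * s ^ 2) ^ m := (mul_pow _ _ _).symm
          _ ≤ (2 * s ^ 2) ^ (n + 1) := e1
          _ = 2 ^ n * (2 * (s * (s ^ n * s ^ (n + 1)))) := by
            rw [mul_pow, ← pow_mul]; ring
          _ ≤ 2 ^ n * (2 * (s⁻¹ * (s ^ n * s ^ m))) := by
            gcongr
            exact h.lt_one.le.trans ((one_le_inv₀ hs0).2 h.lt_one.le)
      rw [mul_comm (block D n _)]
      calc _ ≤ C * (2 ^ m * (s ^ 2) ^ m) * (A * (A / 2 ^ n) * ‖U‖) :=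
            (norm_toL2_mul_le _ _).trans
              (mul_le_mul (h.block_le m) hn (norm_nonneg _) (by positivity))
        _ ≤ C * (2 ^ n * (2 * (s⁻¹ * (s ^ n * s ^ m)))) * (A * (A / 2 ^ n) * ‖U‖) := by gcongr
        _ = K₂ * (s ^ n * s ^ m) := by rw [hK₂]; field_simp
        _ ≤ (K₁ + K₂) * (s ^ n * s ^ m) := by gcongr; linarith

/-- `V u - ∂_x² P_u X` belongs to `L²` for `u ∈ H¹`. -/
theorem BlockBound.summable_potential_add (h : BlockBound D V s C) {u : L2} (hu : u ∈ sobolev 1) :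
    Summable fun j : ℤ => ‖potentialCoeff V u j + (2 * Real.pi * j : ℂ) ^ 2 *
      fourierCoeff (paraproduct D u (invLaplaceCoeff V)) j‖ ^ 2 := by
  obtain ⟨K, hK⟩ := h.exists_remainder hu
  choose z hz hzn using hK
  have hzs : Summable z :=
    Summable.of_norm_bounded ((summable_geometric_prod h.pos h.lt_one).mul_left K) hzn
  refine (hasSum_norm_sq (∑' p, z p)).summable.congr fun j => ?_
  have h1 := hasSum_potentialCoeff D h.memNegSobolev hu j fun p => hz p j
  have h2 := (hasSum_fourierCoeff hzs.hasSum j).sub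
    ((hasSum_fourierCoeff (h.summable_paraTerm u).hasSum j).mul_left ((2 * Real.pi * j : ℂ) ^ 2))
  rw [h1.unique h2, paraproduct, sub_add_cancel]

theorem summable_norm_sq_add {a b : ℤ → ℂ} (ha : Summable fun k => ‖a k‖ ^ 2)
    (hb : Summable fun k => ‖b k‖ ^ 2) : Summable fun k => ‖a k + b k‖ ^ 2 := by
  refine Summable.of_nonneg_of_le (fun k => by positivity) (fun k => ?_) ((ha.add hb).mul_left 2)
  exact (pow_le_pow_left₀ (norm_nonneg _) (norm_add_le _ _) 2).trans (add_sq_le (R := ℝ))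

theorem BlockBound.formOperatorDomain_eq (h : BlockBound D V s C) :
    formOperatorDomain V = paracontrolledDomain D V := by
  ext u
  rw [mem_formOperatorDomain_iff h.memNegSobolev, paracontrolledDomain, Set.mem_ofPred_eq]
  constructor
  · rintro ⟨hu, hs⟩
    rw [mem_sobolev_two_iff]
    have h1 := (h.summable_potential_add hu).congr fun k => by rw [← norm_neg]
    refine (summable_norm_sq_add hs h1).congr fun k => ?_
    rw [fourierCoeff_sub]
    ring_nf
  · intro hu
    -- Only `u ∈ L²` is known so far, which is enough for `P_u X ∈ H^1`; adding the `H²` remainder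
    -- gives the regularity needed below.
    have hu1 : u ∈ sobolev 1 := by
      have := add_mem_sobolev_one (sobolev_two_subset hu) (h.paraproduct_mem u)
      rwa [sub_add_cancel] at this
    refine ⟨hu1, ?_⟩
    rw [mem_sobolev_two_iff] at hu
    refine (summable_norm_sq_add hu (h.summable_potential_add hu1)).congr fun k => ?_
    rw [fourierCoeff_sub]
    ring_nf

/-! ### A criterion for self-adjointness -/

section SelfAdjoint

variable {E : Type*} [NormedAddCommGroup E] [InnerProductSpace ℂ E]
  {H : E →ₗ.[ℂ] E} {μ : ℝ}

theorem inner_add_smul_symm (hsymm : ∀ x y : H.domain, inner ℂ (H x) (y : E) = inner ℂ (x : E) (H y))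
    (x y : H.domain) :
    inner ℂ (H x + (μ : ℂ) • (x : E)) (y : E) = inner ℂ (x : E) (H y + (μ : ℂ) • (y : E)) := by
  rw [inner_add_left, inner_add_right, hsymm, inner_smul_left, inner_smul_right,
    Complex.conj_ofReal]

/-- If `w = (H + μ) z` is orthogonal to the domain and `z = (H + μ) x`, then `⟨z, z⟩ = ⟨x, (H + μ)
z⟩ = ⟨x, w⟩ = 0`. -/
theorem dense_domain_of_surjective [CompleteSpace E]
    (hsymm : ∀ x y : H.domain, inner ℂ (H x) (y : E) = inner ℂ (x : E) (H y))
    (hsurj : ∀ w : E, ∃ x : H.domain, H x + (μ : ℂ) • (x : E) = w) :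
    Dense (H.domain : Set E) := by
  rw [Submodule.dense_iff_topologicalClosure_eq_top, Submodule.topologicalClosure_eq_top_iff,
    Submodule.eq_bot_iff]
  intro w hw
  obtain ⟨z, rfl⟩ := hsurj w
  have hz : (z : E) = 0 := by
    obtain ⟨x, hx⟩ := hsurj z
    rw [← inner_self_eq_zero (𝕜 := ℂ)]
    nth_rewrite 1 [← hx]
    rw [inner_add_smul_symm hsymm]
    exact (Submodule.mem_orthogonal _ _).1 hw _ x.2
  have hz' : z = 0 := Subtype.ext hz
  rw [hz', LinearPMap.map_zero]
  simp

/-- For `y` in the domain of the adjoint, solve `(H + μ) z = (H* + μ) y`. Then `z - y` is orthogonal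
to the range of `H + μ`, which is everything, so `y = z` lies in the domain of `H`. -/
theorem isSelfAdjoint_of_surjective [CompleteSpace E]
    (hsymm : ∀ x y : H.domain, inner ℂ (H x) (y : E) = inner ℂ (x : E) (H y))
    (hsurj : ∀ w : E, ∃ x : H.domain, H x + (μ : ℂ) • (x : E) = w) : IsSelfAdjoint H := by
  have hd := dense_domain_of_surjective hsymm hsurj
  rw [LinearPMap.isSelfAdjoint_def]
  refine le_antisymm (LinearPMap.le_of_le_graph ?_) (LinearPMap.IsFormalAdjoint.le_adjoint hd hsymm)
  rintro ⟨y, w⟩ hyw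
  obtain ⟨y, rfl, rfl⟩ := LinearPMap.mem_graph_iff _ |>.1 hyw
  obtain ⟨z, hz⟩ := hsurj (H.adjoint y + (μ : ℂ) • (y : E))
  have hyz : (z : E) = y := by
    rw [← sub_eq_zero, ← inner_self_eq_zero (𝕜 := ℂ)]
    obtain ⟨x, hx⟩ := hsurj (z - y)
    nth_rewrite 1 [← hx]
    rw [inner_sub_right, inner_add_smul_symm hsymm, hz, sub_eq_zero]
    have := LinearPMap.adjoint_isFormalAdjoint hd y x
    rw [inner_add_left, inner_add_right, inner_smul_left, inner_smul_right, Complex.conj_ofReal]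
    congr 1
    rw [← inner_conj_symm, this, inner_conj_symm]
  rw [hyz] at hz
  rw [LinearPMap.mem_graph_iff]
  exact ⟨z, hyz, add_right_cancel hz⟩

end SelfAdjoint

/-! ### Resolvent of the form -/

/-- Reality is tested on the real functions `e_k + e_{-k}` and `i (e_k - e_{-k})`. -/
theorem CircleDistribution.IsReal.coeff_neg (hV : V.IsReal) (k : ℤ) :
    V.coeff (-k) = conj (V.coeff k) := by
  have hf : ∀ (k : ℤ) (x : UnitAddCircle), (expFun (-k)).1 x = conj ((expFun k).1 x) :=
    fun k x => fourier_neg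
  have h1 := hV (expFun k + expFun (-k)) fun x => by
    change ((expFun k).1 x + (expFun (-k)).1 x).im = 0
    rw [hf, Complex.add_im, Complex.conj_im, add_neg_cancel]
  have h2 := hV (Complex.I • (expFun k - expFun (-k))) fun x => by
    change (Complex.I • ((expFun k).1 x - (expFun (-k)).1 x)).im = 0
    rw [hf, smul_eq_mul, Complex.I_mul_im, Complex.sub_re, Complex.conj_re, sub_self]
  rw [map_add, Complex.add_im] at h1
  rw [map_smul, map_sub, smul_eq_mul, Complex.I_mul_im, Complex.sub_re] at h2
  rw [CircleDistribution.coeff, CircleDistribution.coeff, neg_neg]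
  apply Complex.ext
  · rw [Complex.conj_re]; linarith
  · rw [Complex.conj_im]; linarith

theorem conj_pairTerm (hV : V.IsReal) (u φ : L2) (p : ℤ × ℤ) :
    conj (pairTerm V u φ p) = pairTerm V φ u p.swap := by
  rw [pairTerm, pairTerm, map_mul, map_mul, Complex.conj_conj, ← hV.coeff_neg, neg_sub,
    Prod.fst_swap, Prod.snd_swap]
  ring

theorem conj_tsum_pairTerm (hV : V.IsReal) (u φ : L2) :
    conj (∑' p, pairTerm V u φ p) = ∑' p, pairTerm V φ u p := by
  rw [Complex.conj_tsum]
  simp only [conj_pairTerm hV]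
  exact (Equiv.prodComm ℤ ℤ).tsum_eq (pairTerm V φ u)

theorem conj_form (hV : V.IsReal) (hVs : MemNegSobolev V) {u φ : L2} (hu : u ∈ sobolev 1)
    (hφ : φ ∈ sobolev 1) : conj (form V u φ) = form V φ u := by
  rw [form_eq hVs hu hφ, form_eq hVs hφ hu, map_add, inner_conj_symm, conj_tsum_pairTerm hV]

/-- The symbol of `(μ - ∂_x²)^{1/2}`. -/
def weight (μ : ℝ) (k : ℤ) : ℝ := √(μ + (2 * Real.pi * k) ^ 2)

theorem weight_sq {μ : ℝ} (hμ : 0 ≤ μ) (k : ℤ) : weight μ k ^ 2 = μ + (2 * Real.pi * k) ^ 2 :=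
  Real.sq_sqrt (by positivity)

theorem one_add_abs_le_weight {μ : ℝ} (hμ : 2 ≤ μ) (k : ℤ) : 1 + |(k : ℝ)| ≤ weight μ k := by
  refine Real.le_sqrt_of_sq_le ?_
  have h1 : (|(k : ℝ)|) ^ 2 ≤ ((k : ℝ)) ^ 2 := (sq_abs _).le
  have h2 : 2 * (k : ℝ) ^ 2 ≤ (2 * Real.pi * k) ^ 2 := by
    rw [mul_pow]
    gcongr
    nlinarith [Real.pi_gt_three]
  nlinarith [sq_nonneg (1 - |(k : ℝ)|)]

theorem one_le_weight {μ : ℝ} (hμ : 2 ≤ μ) (k : ℤ) : 1 ≤ weight μ k :=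
  le_trans (by linarith [abs_nonneg (k : ℝ)]) (one_add_abs_le_weight hμ k)

theorem inv_weight_sq_le {μ : ℝ} (hμ : 2 ≤ μ) (k : ℤ) :
    (weight μ k)⁻¹ ^ 2 ≤ (1 + |(k : ℝ)|)⁻¹ ^ 2 := by
  have h := one_add_abs_le_weight hμ k
  exact pow_le_pow_left₀ (inv_nonneg.2 (Real.sqrt_nonneg _)) (inv_anti₀ (by positivity) h) 2

theorem summable_inv_weight_sq {μ : ℝ} (hμ : 2 ≤ μ) : Summable fun k => (weight μ k)⁻¹ ^ 2 :=
  Summable.of_nonneg_of_le (fun _ => by positivity) (inv_weight_sq_le hμ)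
    summable_inv_one_add_abs_sq

/-- Each term tends to zero as `μ → ∞` and is dominated by `(1 + |k|)⁻²`, so dominated convergence
applies to the sum. -/
theorem exists_weight_small {ε : ℝ} (hε : 0 < ε) :
    ∃ μ : ℝ, 2 ≤ μ ∧ √(∑' k, (weight μ k)⁻¹ ^ 2) < ε := by
  have h : Filter.Tendsto (fun μ : ℝ => ∑' k, (weight μ k)⁻¹ ^ 2) Filter.atTop
      (nhds (∑' _ : ℤ, 0)) := by
    refine tendsto_tsum_of_dominated_convergence summable_inv_one_add_abs_sq (fun k => ?_) ?_
    · have h1 : Filter.Tendsto (fun μ : ℝ => (μ + (2 * Real.pi * k) ^ 2)⁻¹) Filter.atTop (nhds 0) :=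
        Filter.Tendsto.inv_tendsto_atTop (Filter.tendsto_atTop_add_const_right _ _ Filter.tendsto_id)
      refine h1.congr' ?_
      filter_upwards [Filter.eventually_ge_atTop 0] with μ hμ
      rw [inv_pow, weight_sq hμ]
    · filter_upwards [Filter.eventually_ge_atTop 2] with μ hμ k
      rw [Real.norm_of_nonneg (by positivity)]
      exact inv_weight_sq_le hμ k
  rw [tsum_zero] at h
  have h2 := h.sqrt
  rw [Real.sqrt_zero] at h2
  obtain ⟨μ, h3, h4⟩ := ((h2.eventually_lt_const hε).and (Filter.eventually_ge_atTop 2)).exists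
  exact ⟨μ, h4, h3⟩

/-- The operator `(μ - ∂_x²)^{-1/2}`. -/
def smoothing (μ : ℝ) (f : L2) : L2 := ofCoeff fun k => ((weight μ k)⁻¹ : ℝ) * fourierCoeff f k

section Smoothing

variable {μ : ℝ}

theorem fourierCoeff_smoothing (hμ : 2 ≤ μ) (f : L2) (k : ℤ) :
    fourierCoeff (smoothing μ f) k = ((weight μ k)⁻¹ : ℝ) * fourierCoeff f k := by
  refine fourierCoeff_ofCoeff (c := fun k => ((weight μ k)⁻¹ : ℝ) * fourierCoeff f k) ?_ k
  refine Summable.of_nonneg_of_le (fun _ => by positivity) (fun k => ?_) (hasSum_norm_sq f).summable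
  have h1 := one_le_weight hμ k
  rw [norm_mul, Complex.norm_real, Real.norm_of_nonneg (by positivity)]
  gcongr
  exact mul_le_of_le_one_left (norm_nonneg _) (inv_le_one_of_one_le₀ h1)

theorem smoothing_add (hμ : 2 ≤ μ) (f g : L2) :
    smoothing μ (f + g) = smoothing μ f + smoothing μ g :=
  ext_fourierCoeff fun k => by
    simp only [fourierCoeff_add, fourierCoeff_smoothing hμ, mul_add]

theorem smoothing_smul (hμ : 2 ≤ μ) (c : ℂ) (f : L2) :
    smoothing μ (c • f) = c • smoothing μ f :=
  ext_fourierCoeff fun k => by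
    simp only [fourierCoeff_smul, fourierCoeff_smoothing hμ]
    ring

theorem smoothing_mem (hμ : 2 ≤ μ) (f : L2) : smoothing μ f ∈ sobolev 1 := by
  rw [mem_sobolev_one_iff]
  refine Summable.of_nonneg_of_le (fun _ => by positivity) (fun k => ?_) (hasSum_norm_sq f).summable
  have h1 := one_le_weight hμ k
  rw [fourierCoeff_smoothing hμ, ← mul_assoc, norm_mul]
  gcongr
  refine mul_le_of_le_one_left (norm_nonneg _) ?_
  rw [norm_mul, norm_two_pi_mul, Complex.norm_real, Real.norm_of_nonneg (by positivity),
    ← div_eq_mul_inv, div_le_one (by positivity)]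
  refine Real.le_sqrt_of_sq_le ?_
  rw [mul_pow, sq_abs, ← mul_pow]
  linarith

theorem exists_smoothing_eq (hμ : 2 ≤ μ) {u : L2} (hu : u ∈ sobolev 1) :
    ∃ f, smoothing μ f = u := by
  have hs : Summable fun k => ‖(weight μ k : ℂ) * fourierCoeff u k‖ ^ 2 := by
    refine (((hasSum_norm_sq u).summable.mul_left μ).add ((mem_sobolev_one_iff u).1 hu)).congr
      fun k => ?_
    rw [norm_mul (2 * Real.pi * k : ℂ), norm_mul (weight μ k : ℂ), norm_two_pi_mul,
      Complex.norm_real, mul_pow _ ‖_‖, mul_pow _ ‖_‖, mul_pow _ |_|, sq_abs, Real.norm_eq_abs, sq_abs, weight_sq (by linarith)]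
    ring
  refine ⟨ofCoeff fun k => (weight μ k : ℂ) * fourierCoeff u k, ext_fourierCoeff fun k => ?_⟩
  have h1 := one_le_weight hμ k
  have h2 : (weight μ k : ℂ) ≠ 0 := by
    rw [Complex.ofReal_ne_zero]; linarith
  rw [fourierCoeff_smoothing hμ, fourierCoeff_ofCoeff hs, Complex.ofReal_inv, inv_mul_cancel_left₀ h2]

theorem inner_smoothing_left (hμ : 2 ≤ μ) (f g : L2) :
    inner ℂ (smoothing μ f) g = inner ℂ f (smoothing μ g) := by
  refine (hasSum_inner _ _).unique ?_
  refine (hasSum_inner f (smoothing μ g)).congr_fun fun k => ?_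
  rw [fourierCoeff_smoothing hμ, fourierCoeff_smoothing hμ, map_mul, Complex.conj_ofReal]
  ring

/-- In the variables `f, g` the operator `μ - ∂_x²` becomes the identity, and only the potential
perturbs the inner product. -/
theorem form_smoothing (hV : MemNegSobolev V) (hμ : 2 ≤ μ) (f g : L2) :
    form V (smoothing μ f) (smoothing μ g) + μ * inner ℂ (smoothing μ g) (smoothing μ f)
      = inner ℂ g f + ∑' p, pairTerm V (smoothing μ f) (smoothing μ g) p := by
  rw [form_eq hV (smoothing_mem hμ f) (smoothing_mem hμ g), add_right_comm]
  congr 1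
  refine HasSum.unique ((hasSum_inner_dx (smoothing_mem hμ f) (smoothing_mem hμ g)).add
    ((hasSum_inner _ _).mul_left (μ : ℂ))) ?_
  refine (hasSum_inner g f).congr_fun fun k => ?_
  have h1 := one_le_weight hμ k
  have h2 : (weight μ k : ℂ) ≠ 0 := by
    rw [Complex.ofReal_ne_zero]; linarith
  have h3 : (weight μ k : ℂ) ^ 2 = μ + (2 * Real.pi * k) ^ 2 := by
    exact_mod_cast weight_sq (by linarith : 0 ≤ μ) k
  rw [fourierCoeff_smoothing hμ, fourierCoeff_smoothing hμ, map_mul, Complex.conj_ofReal]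
  push_cast
  field_simp
  rw [h3]
  ring

theorem norm_tsum_pairTerm_smoothing_le (hV : MemNegSobolev V) (hμ : 2 ≤ μ) (f g : L2) :
    ‖∑' p, pairTerm V (smoothing μ f) (smoothing μ g) p‖
      ≤ 2 * √(∑' k : ℤ, (‖V.coeff k‖ / (1 + |(k : ℝ)|)) ^ 2) * √(∑' k, (weight μ k)⁻¹ ^ 2)
        * ‖f‖ * ‖g‖ := by
  have h := summable_potential_form hV (one_add_abs_le_weight hμ) (summable_inv_weight_sq hμ)
    (fun k => norm_nonneg (fourierCoeff f k)) (fun k => norm_nonneg (fourierCoeff g k))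
    (hasSum_norm_sq f).summable (hasSum_norm_sq g).summable
  rw [(hasSum_norm_sq f).tsum_eq, (hasSum_norm_sq g).tsum_eq, Real.sqrt_sq (norm_nonneg _),
    Real.sqrt_sq (norm_nonneg _)] at h
  refine (tsum_of_norm_bounded h.1.hasSum fun p => ?_).trans h.2
  have hw : ∀ k, ‖(((weight μ k)⁻¹ : ℝ) : ℂ)‖ = (weight μ k)⁻¹ := fun k => by
    rw [Complex.norm_real, Real.norm_of_nonneg]
    have := one_le_weight hμ k
    positivity
  rw [pairTerm, norm_mul, norm_mul, RCLike.norm_conj, fourierCoeff_smoothing hμ,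
    fourierCoeff_smoothing hμ, norm_mul, norm_mul, hw, hw]
  apply le_of_eq
  ring

end Smoothing

/-- The form is coercive after a shift: `H + μ` is onto for large `μ`. -/
theorem exists_shift_surjective (hVr : V.IsReal) (hV : MemNegSobolev V) :
    ∃ μ : ℝ, ∀ w : L2, ∃ u v : L2, IsImage V u v ∧ v + (μ : ℂ) • u = w := by
  set N := √(∑' k : ℤ, (‖V.coeff k‖ / (1 + |(k : ℝ)|)) ^ 2) with hN
  have hN0 : 0 ≤ N := Real.sqrt_nonneg _
  -- With this threshold the perturbation has norm at most `2N / (4N + 1) ≤ 1/2`.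
  obtain ⟨μ, hμ, hsmall⟩ := exists_weight_small (ε := (4 * N + 1)⁻¹) (by positivity)
  refine ⟨μ, fun w => ?_⟩
  have hbound : ∀ f g : L2, ‖∑' p, pairTerm V (smoothing μ f) (smoothing μ g) p‖
      ≤ 1 / 2 * ‖f‖ * ‖g‖ := fun f g => by
    refine (norm_tsum_pairTerm_smoothing_le hV hμ f g).trans ?_
    gcongr
    calc 2 * N * √(∑' k, (weight μ k)⁻¹ ^ 2) ≤ 2 * N * (4 * N + 1)⁻¹ := by gcongr
      _ ≤ 1 / 2 := by rw [← div_eq_mul_inv, div_le_iff₀ (by positivity)]; linarith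
  have hsum := fun f g : L2 => summable_pairTerm hV (smoothing_mem hμ f) (smoothing_mem hμ g)
  let B : L2 →L⋆[ℂ] L2 →L[ℂ] ℂ := LinearMap.mkContinuous₂
    (LinearMap.mk₂'ₛₗ (starRingEnd ℂ) (RingHom.id ℂ)
      (fun f g => ∑' p, pairTerm V (smoothing μ g) (smoothing μ f) p)
      (fun f₁ f₂ g => by
        rw [← (hsum g f₁).tsum_add (hsum g f₂)]
        refine tsum_congr fun p => ?_
        simp only [pairTerm, smoothing_add hμ, fourierCoeff_add, map_add, mul_add])
      (fun c f g => by
        rw [smul_eq_mul, ← tsum_mul_left]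
        refine tsum_congr fun p => ?_
        simp only [pairTerm, smoothing_smul hμ, fourierCoeff_smul, map_mul]
        ring)
      (fun f g₁ g₂ => by
        rw [← (hsum g₁ f).tsum_add (hsum g₂ f)]
        refine tsum_congr fun p => ?_
        simp only [pairTerm, smoothing_add hμ, fourierCoeff_add]
        ring)
      (fun c f g => by
        rw [RingHom.id_apply, smul_eq_mul, ← tsum_mul_left]
        refine tsum_congr fun p => ?_
        simp only [pairTerm, smoothing_smul hμ, fourierCoeff_smul]
        ring))
    (1 / 2) (fun f g => (hbound g f).trans_eq (by ring))
  have hB : ∀ f g, B f g = ∑' p, pairTerm V (smoothing μ g) (smoothing μ f) p := fun f g => rfl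
  -- The perturbing form is represented by an operator of norm at most `1/2`, so `1 + T` is
  -- invertible.
  set T := InnerProductSpace.continuousLinearMapOfBilin B with hT
  have hTB : ∀ f g, inner ℂ (T f) g = B f g :=
    InnerProductSpace.continuousLinearMapOfBilin_apply B
  have hTn : ‖-T‖ < 1 := by
    rw [norm_neg]
    refine lt_of_le_of_lt (T.opNorm_le_bound (M := 1 / 2) (by norm_num) fun f => ?_) (by norm_num)
    have h1 : ‖T f‖ * ‖T f‖ ≤ 1 / 2 * ‖f‖ * ‖T f‖ := by
      rw [← inner_self_eq_norm_mul_norm (𝕜 := ℂ), inner_self_re_eq_norm, hTB, hB]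
      exact (hbound _ _).trans_eq (by ring)
    rcases (norm_nonneg (T f)).eq_or_lt with h0 | h0
    · rw [← h0]; positivity
    · exact le_of_mul_le_mul_right h1 h0
  obtain ⟨a, ha⟩ := isUnit_one_sub_of_norm_lt_one hTn
  set f : L2 := (↑a⁻¹ : L2 →L[ℂ] L2) (smoothing μ w) with hf
  have hfe : f + T f = smoothing μ w := by
    have h1 : (1 - -T) f = smoothing μ w := by
      rw [← ha, hf, ← mul_apply_eq_comp, Units.mul_inv, one_apply_eq_self]
    simpa using h1
  -- Every test function in `H^1` is `smoothing μ g` for some `g`, so the weak equation for `u` is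
  -- equivalent to `f + T f = smoothing μ w`.
  refine ⟨smoothing μ f, w - (μ : ℂ) • smoothing μ f, ⟨smoothing_mem hμ f, fun φ hφ => ?_⟩,
    sub_add_cancel _ _⟩
  obtain ⟨g, rfl⟩ := exists_smoothing_eq hμ hφ
  rw [inner_sub_right, inner_smul_right, eq_sub_iff_add_eq, form_smoothing hV hμ,
    inner_smoothing_left hμ, ← hfe, inner_add_right, ← inner_conj_symm g (T f), hTB, hB,
    conj_tsum_pairTerm hVr]

/-! ### The operator -/

theorem potentialCoeff_zero (V : CircleDistribution) (j : ℤ) : potentialCoeff V 0 j = 0 := by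
  simp only [potentialCoeff, fourierCoeff_zero, mul_zero, tsum_zero]

/-- The graph of the operator of the form. -/
def formGraph (hV : MemNegSobolev V) : Submodule ℂ (L2 × L2) where
  carrier := {x | IsImage V x.1 x.2}
  zero_mem' := by
    rw [Set.mem_ofPred_eq, isImage_iff hV, mem_sobolev_one_iff, Prod.fst_zero, Prod.snd_zero]
    simp only [potentialCoeff_zero, fourierCoeff_zero, mul_zero, add_zero, norm_zero, implies_true,
      and_true]
    exact summable_zero.congr fun _ => (zero_pow two_ne_zero).symm
  add_mem' {x y} hx hy := by
    rw [Set.mem_ofPred_eq, isImage_iff hV] at *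
    refine ⟨add_mem_sobolev_one hx.1 hy.1, fun j => ?_⟩
    have h : potentialCoeff V (x.1 + y.1) j = potentialCoeff V x.1 j + potentialCoeff V y.1 j := by
      rw [potentialCoeff, potentialCoeff, potentialCoeff,
        ← (summable_potentialCoeff hV hx.1 j).tsum_add (summable_potentialCoeff hV hy.1 j)]
      simp only [fourierCoeff_add, mul_add]
    rw [Prod.fst_add, Prod.snd_add, fourierCoeff_add, fourierCoeff_add, h, ← hx.2, ← hy.2]
    ring
  smul_mem' c x hx := by
    rw [Set.mem_ofPred_eq, isImage_iff hV] at *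
    refine ⟨smul_mem_sobolev_one c hx.1, fun j => ?_⟩
    have h : potentialCoeff V (c • x.1) j = c * potentialCoeff V x.1 j := by
      rw [potentialCoeff, potentialCoeff, ← tsum_mul_left]
      refine tsum_congr fun l => ?_
      rw [fourierCoeff_smul]
      ring
    rw [Prod.smul_fst, Prod.smul_snd, fourierCoeff_smul, fourierCoeff_smul, h, ← hx.2]
    ring

/-- The operator `H = -∂_x² + V`. -/
def formOperator (hV : MemNegSobolev V) : L2 →ₗ.[ℂ] L2 := (formGraph hV).toLinearPMap

theorem mem_graph_formOperator (hV : MemNegSobolev V) (u v : L2) :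
    (u, v) ∈ (formOperator hV).graph ↔ IsImage V u v := by
  rw [formOperator, Submodule.toLinearPMap_graph_eq]
  · rfl
  -- Single-valuedness of the graph: the coefficients of `v` are determined by `u`.
  · rintro ⟨u, v⟩ hx (rfl : u = 0)
    have h : IsImage V 0 v := hx
    rw [isImage_iff hV] at h
    refine ext_fourierCoeff fun k => ?_
    rw [← h.2, fourierCoeff_zero, potentialCoeff_zero, mul_zero, add_zero]

theorem isImage_formOperator (hV : MemNegSobolev V) (x : (formOperator hV).domain) :
    IsImage V x (formOperator hV x) :=
  (mem_graph_formOperator hV _ _).1 (LinearPMap.mem_graph _ x)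

theorem coe_domain_formOperator (hV : MemNegSobolev V) :
    ((formOperator hV).domain : Set L2) = formOperatorDomain V := by
  ext u
  refine ⟨fun hu => ⟨_, isImage_formOperator hV ⟨u, hu⟩⟩, ?_⟩
  rintro ⟨v, hv⟩
  exact LinearPMap.mem_domain_of_mem_graph ((mem_graph_formOperator hV u v).2 hv)

theorem formOperator_symm (hVr : V.IsReal) (hV : MemNegSobolev V)
    (x y : (formOperator hV).domain) :
    inner ℂ (formOperator hV x) (y : L2) = inner ℂ (x : L2) (formOperator hV y) := by
  have hx := isImage_formOperator hV x
  have hy := isImage_formOperator hV y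
  rw [← hy.2 x hx.1, ← inner_conj_symm, ← hx.2 y hy.1, conj_form hVr hV hx.1 hy.1]

theorem exists_formOperator_add_smul (hVr : V.IsReal) (hV : MemNegSobolev V) :
    ∃ μ : ℝ, ∀ w : L2, ∃ x : (formOperator hV).domain,
      formOperator hV x + (μ : ℂ) • (x : L2) = w := by
  obtain ⟨μ, hμ⟩ := exists_shift_surjective hVr hV
  refine ⟨μ, fun w => ?_⟩
  obtain ⟨u, v, huv, hw⟩ := hμ w
  obtain ⟨x, rfl, rfl⟩ := (LinearPMap.mem_graph_iff _).1 ((mem_graph_formOperator hV u v).2 huv)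
  exact ⟨x, hw⟩

end PeriodicSchrodinger

end

theorem mainTheorem7 (D : PeriodicSchrodinger.DyadicPartition) (κ : ℝ) (hκ₀ : 0 < κ) (hκ₁ : κ < 1)
    (V : PeriodicSchrodinger.CircleDistribution) (hVreal : V.IsReal)
    (hV : PeriodicSchrodinger.MemHolderBesov D (-1 + κ) V.coeff) :
    -- the series defining the form on `H^1` and the paraproduct on `L²` converge
    (∀ u ∈ PeriodicSchrodinger.sobolev 1, ∀ φ ∈ PeriodicSchrodinger.sobolev 1,
      Summable (PeriodicSchrodinger.potentialTerm V u φ)) ∧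
    (∀ u : PeriodicSchrodinger.L2,
      Summable (PeriodicSchrodinger.paraTerm D u (PeriodicSchrodinger.invLaplaceCoeff V))) ∧
    -- the form domain of the operator is the paracontrolled domain
    PeriodicSchrodinger.formOperatorDomain V = PeriodicSchrodinger.paracontrolledDomain D V ∧
    -- the operator of the form is a densely defined self-adjoint operator, and it is closed with
    -- domain the paracontrolled domain
    ∃ H : PeriodicSchrodinger.L2 →ₗ.[ℂ] PeriodicSchrodinger.L2,
      (∀ u v : PeriodicSchrodinger.L2,
        (u, v) ∈ H.graph ↔ PeriodicSchrodinger.IsImage V u v) ∧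
      Dense (H.domain : Set PeriodicSchrodinger.L2) ∧
      IsSelfAdjoint H ∧
      (H.domain : Set PeriodicSchrodinger.L2) = PeriodicSchrodinger.paracontrolledDomain D V ∧
      H.IsClosed := by
  -- From here on the Hölder-Besov regularity is used only through the block bounds.
  obtain ⟨s, C, h⟩ := hV.exists_blockBound hκ₀ hκ₁
  have hVs := h.memNegSobolev
  obtain ⟨μ, hμ⟩ := PeriodicSchrodinger.exists_formOperator_add_smul hVreal hVs
  have hsymm := PeriodicSchrodinger.formOperator_symm hVreal hVs
  have hsa := PeriodicSchrodinger.isSelfAdjoint_of_surjective hsymm hμ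
  refine ⟨fun u hu φ hφ => (PeriodicSchrodinger.hasSum_potentialTerm hVs hu hφ).summable,
    h.summable_paraTerm, h.formOperatorDomain_eq, PeriodicSchrodinger.formOperator hVs,
    PeriodicSchrodinger.mem_graph_formOperator hVs, hsa.dense_domain, hsa, ?_, hsa.isClosed⟩
  rw [PeriodicSchrodinger.coe_domain_formOperator, h.formOperatorDomain_eq]
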